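/- For every $\alpha\ge 1$ there is a constant $C=C(\alpha)<\infty$, depending only on $\alpha$, such that the following holds. Let $n\ge 1$ and let $(X_{ij})_{1\le i,j\le n}$ be independent, integrable, mean zero real random variables on a probability space with $$\|X_{ij}\|_{2p}\le \alpha\|X_{ij}\|_p\qquad\text{for all } i,j\le n \text{ and all real } p\ge 1,$$ where $\|S\|_p=(\mathbb E|S|^p)^{1/p}$ for a random variable $S$ and real $p>0$. Then $$\max_{1\le i\le n}\Big(\sum_{j=1}^n\mathbb E X_{ij}^2\Big)^{1/2}+\max_{1\le j\le n}\Big(\sum_{i=1}^n\mathbb E X_{ij}^2\Big)^{1/2}+\max_{1\le k\le n}\ \min_{I\subset\{1,\dots,n\},\,|I|\le k}\ \sup_{\|s\|_2,\|t\|_2\le 1}\Big\|\sum_{i,j\notin I}X_{ij}s_it_j\Big\|_{\log(k+1)}\le C\,\mathbb E\|(X_{ij})_{i,j\le n}\|.$$ Here $\|(X_{ij})\|$ is the operator norm of the random matrix on $\mathbb R^n$ with the Euclidean norm, $s,t$ range over $\mathbb R^n$, the last sum is over all pairs $(i,j)$ with both $i\notin I$ and $j\notin I$, and $\log$ is the natural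 logarithm. -/

import Mathlib

open MeasureTheory ProbabilityTheory
open scoped NNReal ENNReal

/-! Expectations, `L_p`-norms, maxima and suprema below are all taken in `[0, ∞]`, so that no
operator has a junk value. -/

namespace RandomMatrixLower

noncomputable section

variable {Ω : Type*} [MeasurableSpace Ω]

/-- `‖S‖_p = (𝔼 |S|^p)^{1/p}` for a real exponent `p > 0` (`p < 1` is allowed). -/
def lpNormRV (μ : Measure Ω) (p : ℝ) (S : Ω → ℝ) : ℝ≥0∞ :=
  eLpNorm S (ENNReal.ofReal p) μ

/-- `𝔼 ‖(X_ij)‖`, with the operator norm `ℓ₂ⁿ → ℓ₂ⁿ`. -/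
def expOpNorm (μ : Measure Ω) {n : ℕ} (X : Fin n → Fin n → Ω → ℝ) : ℝ≥0∞ :=
  ∫⁻ ω, ‖Matrix.toEuclideanCLM (n := Fin n) (𝕜 := ℝ) (Matrix.of fun i j => X i j ω)‖ₑ ∂μ

/-- `max_i (∑_j 𝔼 X_ij²)^{1/2}`. -/
def maxRow (μ : Measure Ω) {n : ℕ} (X : Fin n → Fin n → Ω → ℝ) : ℝ≥0∞ :=
  ⨆ i, (∑ j, ∫⁻ ω, ENNReal.ofReal (X i j ω ^ 2) ∂μ) ^ (1 / 2 : ℝ)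

/-- `max_j (∑_i 𝔼 X_ij²)^{1/2}`. -/
def maxCol (μ : Measure Ω) {n : ℕ} (X : Fin n → Fin n → Ω → ℝ) : ℝ≥0∞ :=
  ⨆ j, (∑ i, ∫⁻ ω, ENNReal.ofReal (X i j ω ^ 2) ∂μ) ^ (1 / 2 : ℝ)

/-- `sup_{‖s‖₂, ‖t‖₂ ≤ 1} ‖∑_{i, j ∉ I} X_ij s_i t_j‖_p`. -/
def weakNormOutside (μ : Measure Ω) {n : ℕ} (X : Fin n → Fin n → Ω → ℝ)
    (I : Finset (Fin n)) (p : ℝ) : ℝ≥0∞ :=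
  ⨆ (s : EuclideanSpace ℝ (Fin n)) (t : EuclideanSpace ℝ (Fin n)) (_ : ‖s‖ ≤ 1) (_ : ‖t‖ ≤ 1),
    lpNormRV μ p (fun ω => ∑ i ∈ Iᶜ, ∑ j ∈ Iᶜ, X i j ω * s i * t j)

/-- `max_{1 ≤ k ≤ n} min_{I ⊆ [n], |I| ≤ k} sup_{‖s‖₂, ‖t‖₂ ≤ 1}
‖∑_{i, j ∉ I} X_ij s_i t_j‖_{log (k + 1)}`. -/
def maxMinWeak (μ : Measure Ω) {n : ℕ} (X : Fin n → Fin n → Ω → ℝ) : ℝ≥0∞ :=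
  ⨆ k ∈ Finset.Icc 1 n, ⨅ (I : Finset (Fin n)) (_ : I.card ≤ k),
    weakNormOutside μ X I (Real.log ((k : ℝ) + 1))

end

end RandomMatrixLower

open MeasureTheory ProbabilityTheory
open scoped NNReal ENNReal
open RandomMatrixLower

/-! Write `M` for the expected operator norm. For a row or column, test the matrix against the
random vector of signs of its entries weighted by their first moments: this bounds the ℓ₂ norm of
the first moments by `M`, and regularity at `p = 1` passes to second moments.

For the third summand the main tool is that linear combinations `S` of the entries inherit regular
growth, `‖S‖_{4r} ≤ 8α ‖S‖_{2r}` (`eLpNorm_sum_le`). It follows from a hypercontractive inequality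
with a free shift, which holds for each symmetrized entry (`isHypercontractive_of_symm`) and
survives convolution (`IsHypercontractive.conv`).

Fix `k`, put `L = log (k + 1)`, and suppose that every `I` with `|I| ≤ k` fails. For small `L` the
second-moment bound and growth of moments suffice. For large `L`, the coordinates of `s, t` below `τ
= e^{-L/8}` contribute little: the variance of the form carries a factor `τ²`, and raising the
exponent from `2` to about `L` costs only a power of `L`. What remains is supported on at most `2
e^{L/4}` coordinates. Letting `I` be the union of the supports already found, a greedy choice yields
`N ≥ e^{L/4}` forms with disjoint supports, hence independent, each with `2^p`-th moment norm above
`6M`, where `2^p` is a small fraction of `L`. By Paley–Zygmund each exceeds `3M` with probability at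
least `1/N`, so with probability at least `1/2` one of them does. Then `M ≥ 3M/2`, which is absurd
for `0 < M < ∞`. -/

/-! ### A two-point inequality for even binomial sums. -/

/-- The even part of the binomial expansion of `(a + z) ^ (2 * n)` as a polynomial in `w = z ^ 2`. -/
noncomputable def evenSum (n : ℕ) (a w : ℝ) : ℝ :=
  ∑ i ∈ Finset.range (n + 1), ((2 * n).choose (2 * i) : ℝ) * (a ^ 2) ^ (n - i) * w ^ i

theorem sum_range_two_mul_add_one (f : ℕ → ℝ) (n : ℕ) :
    ∑ m ∈ Finset.range (2 * n + 1), f m =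
      ∑ i ∈ Finset.range (n + 1), f (2 * i) + ∑ i ∈ Finset.range n, f (2 * i + 1) := by
  induction n with
  | zero => simp
  | succ n ih =>
    rw [show 2 * (n + 1) + 1 = 2 * n + 1 + 1 + 1 by ring, Finset.sum_range_succ,
      Finset.sum_range_succ, ih, Finset.sum_range_succ _ (n + 1), Finset.sum_range_succ _ n,
      Finset.sum_range_succ (fun i => f (2 * i + 1)) n]
    simp only [show 2 * n + 1 + 1 = 2 * (n + 1) by ring]
    ring

theorem evenSum_sq (n : ℕ) (a z : ℝ) :
    evenSum n a (z ^ 2) = ((a + z) ^ (2 * n) + (a - z) ^ (2 * n)) / 2 := by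
  rw [add_comm a z, show a - z = -z + a by ring, add_pow, add_pow, ← Finset.sum_add_distrib,
    sum_range_two_mul_add_one]
  have h : ∀ i ∈ Finset.range n, z ^ (2 * i + 1) * a ^ (2 * n - (2 * i + 1)) *
      ((2 * n).choose (2 * i + 1) : ℝ) + (-z) ^ (2 * i + 1) * a ^ (2 * n - (2 * i + 1)) *
      ((2 * n).choose (2 * i + 1) : ℝ) = 0 := by
    intro i _
    rw [Odd.neg_pow ⟨i, rfl⟩]
    ring
  rw [Finset.sum_eq_zero h, add_zero, Finset.sum_div, evenSum]
  refine Finset.sum_congr rfl fun i _ => ?_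
  rw [Even.neg_pow (even_two_mul i), ← pow_mul, ← pow_mul, Nat.mul_sub]
  ring

/-- Bernoulli's inequality in homogeneous form, which avoids dividing by `b`. -/
theorem pow_succ_sub_le_sub_pow {b w : ℝ} (hw : 0 ≤ w) (hb : w ≤ b) (n : ℕ) :
    b ^ (n + 1) - (n + 1) * b ^ n * w ≤ (b - w) ^ (n + 1) := by
  have hb0 : 0 ≤ b := hw.trans hb
  induction n with
  | zero => simp
  | succ n ih =>
    have h := mul_le_mul_of_nonneg_left ih (sub_nonneg.2 hb)
    rw [pow_succ' (b - w)]
    refine le_trans ?_ h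
    have : 0 ≤ ((n : ℝ) + 1) * b ^ n * w ^ 2 := by positivity
    push_cast
    have e : (b - w) * (b ^ (n + 1) - (n + 1) * b ^ n * w) =
      b ^ (n + 1 + 1) - (n + 1 + 1) * b ^ (n + 1) * w + ((n : ℝ) + 1) * b ^ n * w ^ 2 := by ring
    linarith

/-- With `w = z²` and a random sign `ε`, this is `𝔼 (a + εz/2)^{4r} ≤ (𝔼 (a + εz)^{2r})²`. The right
side equals half of `evenSum (2 * r) a w` plus `(a² - z²)^{2r} / 2`. Quartering `w` divides the
nonconstant part `G` by at least 4; the spare quarter of `G`, through its linear term alone, pays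
for the Bernoulli loss in `(a² - z²)^{2r}`. -/
theorem two_point_ineq {r : ℕ} (hr : 1 ≤ r) (a : ℝ) {w : ℝ} (hw : 0 ≤ w) :
    evenSum (2 * r) a (w / 4) ≤ evenSum r a w ^ 2 := by
  obtain ⟨z, rfl⟩ : ∃ z, w = z ^ 2 := ⟨√w, (Real.sq_sqrt hw).symm⟩
  obtain ⟨m, hm⟩ : ∃ m, 2 * r = m + 1 := ⟨2 * r - 1, by omega⟩
  have hm1 : (1 : ℝ) ≤ m := by exact_mod_cast (by omega : 1 ≤ m)
  have hsq : evenSum r a (z ^ 2) ^ 2 =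
      evenSum (2 * r) a (z ^ 2) / 2 + (a ^ 2 - z ^ 2) ^ (2 * r) / 2 := by
    rw [evenSum_sq, evenSum_sq, show a ^ 2 - z ^ 2 = (a + z) * (a - z) by ring, mul_pow]
    ring
  rw [hsq]
  set G : ℝ → ℝ := fun w => ∑ i ∈ Finset.range (2 * r),
    ((2 * (2 * r)).choose (2 * (i + 1)) : ℝ) * (a ^ 2) ^ (2 * r - (i + 1)) * w ^ (i + 1) with hG
  have hE : ∀ w, evenSum (2 * r) a w = (a ^ 2) ^ (2 * r) + G w := by
    intro w
    rw [evenSum, Finset.sum_range_succ', hG]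
    simp [add_comm]
  have hG1 : G (z ^ 2 / 4) ≤ G (z ^ 2) / 4 := by
    simp only [hG, Finset.sum_div]
    refine Finset.sum_le_sum fun i _ => ?_
    rw [mul_div_assoc]
    refine mul_le_mul_of_nonneg_left ?_ (by positivity)
    rw [div_pow, pow_succ (4 : ℝ)]
    refine div_le_div_of_nonneg_left (by positivity) (by norm_num) ?_
    have : (1 : ℝ) ≤ 4 ^ i := one_le_pow₀ (by norm_num)
    linarith
  have hG2 : (m + 1) * (2 * m + 1) * (a ^ 2) ^ m * z ^ 2 ≤ G (z ^ 2) := by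
    have h0 : (0 : ℕ) ∈ Finset.range (2 * r) := Finset.mem_range.2 (by omega)
    refine le_trans (le_of_eq ?_) (Finset.single_le_sum (f := fun i =>
      ((2 * (2 * r)).choose (2 * (i + 1)) : ℝ) * (a ^ 2) ^ (2 * r - (i + 1)) * (z ^ 2) ^ (i + 1))
      (fun i _ => by positivity) h0)
    simp only [hm, zero_add, mul_one, pow_one, Nat.add_sub_cancel]
    rw [Nat.cast_choose_two]
    push_cast
    ring
  have hB : (a ^ 2) ^ (2 * r) - (m + 1) * (a ^ 2) ^ m * z ^ 2 ≤ (a ^ 2 - z ^ 2) ^ (2 * r) := by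
    rcases le_total (z ^ 2) (a ^ 2) with h | h
    · rw [hm]
      exact pow_succ_sub_le_sub_pow (sq_nonneg z) h m
    -- When `a² < z²` Bernoulli is not available, but the left side is then nonpositive and the even
    -- power nonnegative.
    · refine le_trans ?_ (Even.pow_nonneg (even_two_mul r) _)
      rw [hm, pow_succ]
      have h1 : 0 ≤ (a ^ 2) ^ m := by positivity
      have h2 := mul_le_mul_of_nonneg_left h h1
      have h3 : 0 ≤ m * ((a ^ 2) ^ m * z ^ 2) := by positivity
      linarith
  rw [hE, hE]
  have h4 : 0 ≤ (m + 1) * (a ^ 2) ^ m * z ^ 2 := by positivity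
  nlinarith

theorem evenSum_mul_sq_le (r : ℕ) (a : ℝ) (y y' : ℝ) :
    evenSum r a (|y| * |y'|) ^ 2 ≤ evenSum r a (y ^ 2) * evenSum r a (y' ^ 2) := by
  unfold evenSum
  refine Finset.sum_sq_le_sum_mul_sum_of_sq_le_mul _ (fun i _ => by positivity)
    (fun i _ => by positivity) fun i _ => le_of_eq ?_
  rw [← sq_abs y, ← sq_abs y']
  ring

/-! ### Hypercontractivity of one law and its stability under convolution. -/

/-- Two-function hypercontractivity of a law on `ℝ`, between the exponents `4 * r` and `2 * r`. -/
def IsHypercontractive (r : ℕ) (ρ : ℝ) (κ : Measure ℝ) : Prop :=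
  ∀ a : ℝ, ∫⁻ y, ‖a + ρ * y‖ₑ ^ (4 * r) ∂κ ≤ (∫⁻ y, ‖a + y‖ₑ ^ (2 * r) ∂κ) ^ 2

theorem enorm_pow_two_mul (x : ℝ) (n : ℕ) : ‖x‖ₑ ^ (2 * n) = ENNReal.ofReal (x ^ (2 * n)) := by
  rw [Real.enorm_eq_ofReal_abs, ← ENNReal.ofReal_pow (abs_nonneg x), Even.pow_abs (even_two_mul n)]

section Single

variable {κ : Measure ℝ} [IsProbabilityMeasure κ]

theorem integrable_affine_pow (hmem : ∀ p : ℕ, MemLp (fun y : ℝ => y) p κ) (a c : ℝ) (n : ℕ) :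
    Integrable (fun y => (a + c * y) ^ (2 * n)) κ := by
  have h : MemLp (fun y => a + c * y) (2 * n : ℕ) κ :=
    (memLp_const a).add ((hmem _).const_mul c)
  simpa [Even.pow_abs (even_two_mul n)] using h.integrable_norm_pow'

theorem integrable_abs_pow (hmem : ∀ p : ℕ, MemLp (fun y : ℝ => y) p κ) (n : ℕ) :
    Integrable (fun y => |y| ^ n) κ := by
  simpa using (hmem n).integrable_norm_pow'

theorem integral_evenSum (hmem : ∀ p : ℕ, MemLp (fun y : ℝ => y) p κ) (n : ℕ) (a c : ℝ) :
    ∫ y, evenSum n a (c * y ^ 2) ∂κ = ∑ i ∈ Finset.range (n + 1),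
      ((2 * n).choose (2 * i) : ℝ) * (a ^ 2) ^ (n - i) * (c ^ i * ∫ y, |y| ^ (2 * i) ∂κ) := by
  unfold evenSum
  rw [integral_finsetSum]
  · refine Finset.sum_congr rfl fun i _ => ?_
    rw [integral_const_mul, ← integral_const_mul (c ^ i)]
    congr 2 with y
    rw [mul_pow, pow_mul, sq_abs]
  · intro i _
    refine Integrable.const_mul ?_ _
    refine ((integrable_abs_pow hmem (2 * i)).const_mul (c ^ i)).congr
      (Filter.Eventually.of_forall fun y => ?_)
    simp only
    rw [mul_pow, pow_mul |y|, sq_abs]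

theorem integrable_evenSum_prod (hmem : ∀ p : ℕ, MemLp (fun y : ℝ => y) p κ) (n : ℕ) (a c : ℝ) :
    Integrable (fun z : ℝ × ℝ => evenSum n a (c * (|z.1| * |z.2|))) (κ.prod κ) := by
  unfold evenSum
  refine integrable_finsetSum _ fun i _ => Integrable.const_mul ?_ _
  refine (((integrable_abs_pow hmem i).mul_prod (integrable_abs_pow hmem i)).const_mul
    (c ^ i)).congr (Filter.Eventually.of_forall fun z => ?_)
  simp only
  ring

theorem integral_evenSum_prod (hmem : ∀ p : ℕ, MemLp (fun y : ℝ => y) p κ) (n : ℕ) (a c : ℝ) :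
    ∫ z, evenSum n a (c * (|z.1| * |z.2|)) ∂(κ.prod κ) = ∑ i ∈ Finset.range (n + 1),
      ((2 * n).choose (2 * i) : ℝ) * (a ^ 2) ^ (n - i) * (c ^ i * (∫ y, |y| ^ i ∂κ) ^ 2) := by
  unfold evenSum
  rw [integral_finsetSum]
  · refine Finset.sum_congr rfl fun i _ => ?_
    rw [integral_const_mul, sq (∫ y, |y| ^ i ∂κ),
      ← integral_prod_mul (fun y : ℝ => |y| ^ i) fun y : ℝ => |y| ^ i, ← integral_const_mul (c ^ i)]
    congr 2 with z
    ring
  · intro i _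
    refine Integrable.const_mul ?_ _
    refine (((integrable_abs_pow hmem i).mul_prod (integrable_abs_pow hmem i)).const_mul
      (c ^ i)).congr (Filter.Eventually.of_forall fun z => ?_)
    simp only
    ring

theorem integral_affine_pow (hmem : ∀ p : ℕ, MemLp (fun y : ℝ => y) p κ)
    (hsymm : κ.map (fun y => -y) = κ) (n : ℕ) (a c : ℝ) :
    ∫ y, (a + c * y) ^ (2 * n) ∂κ = ∫ y, evenSum n a (c ^ 2 * y ^ 2) ∂κ := by
  have h : ∫ y, (a - c * y) ^ (2 * n) ∂κ = ∫ y, (a + c * y) ^ (2 * n) ∂κ := by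
    conv_rhs => rw [← hsymm]
    rw [integral_map (by fun_prop) (by fun_prop)]
    simp [sub_eq_add_neg]
  have h2 : Integrable (fun y => (a - c * y) ^ (2 * n)) κ := by
    simpa [sub_eq_add_neg] using integrable_affine_pow hmem a (-c) n
  simp_rw [← mul_pow, evenSum_sq]
  rw [integral_div, integral_add (integrable_affine_pow hmem a c n) h2, h]
  ring

/-- Symmetry removes the odd moments, so both sides are averages of `evenSum`. Regularity replaces
`𝔼 y^{2i}` by `(𝔼 |y|^i)²`, that is, `y²` by `|y| |y'|` for an independent copy `y'`. Then
`two_point_ineq` applies pointwise, and Cauchy–Schwarz on the coefficients (`evenSum_mul_sq_le`)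
separates `y` from `y'`. -/
theorem isHypercontractive_of_symm (hmem : ∀ p : ℕ, MemLp (fun y : ℝ => y) p κ)
    (hsymm : κ.map (fun y => -y) = κ) {β : ℝ} (hβ : 0 < β)
    (hreg : ∀ l : ℕ, 1 ≤ l → ∫ y, |y| ^ (2 * l) ∂κ ≤ β ^ (2 * l) * (∫ y, |y| ^ l ∂κ) ^ 2)
    {r : ℕ} (hr : 1 ≤ r) : IsHypercontractive r (1 / (2 * β)) κ := by
  intro a
  set ρ := 1 / (2 * β) with hρ
  -- The factor 2 in `ρ` produces exactly the quarter that `two_point_ineq` asks for.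
  have hρβ : ρ ^ 2 * β ^ 2 = 1 / 4 := by rw [hρ]; field_simp; norm_num
  have key : ∫ y, (a + ρ * y) ^ (2 * (2 * r)) ∂κ ≤ (∫ y, (a + 1 * y) ^ (2 * r) ∂κ) ^ 2 := by
    rw [integral_affine_pow hmem hsymm, integral_affine_pow hmem hsymm]
    calc ∫ y, evenSum (2 * r) a (ρ ^ 2 * y ^ 2) ∂κ
        ≤ ∫ z, evenSum (2 * r) a (1 / 4 * (|z.1| * |z.2|)) ∂(κ.prod κ) := by
          rw [integral_evenSum hmem, integral_evenSum_prod hmem]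
          refine Finset.sum_le_sum fun i _ => mul_le_mul_of_nonneg_left ?_ (by positivity)
          rcases Nat.eq_zero_or_pos i with rfl | hi
          · simp
          · calc (ρ ^ 2) ^ i * ∫ y, |y| ^ (2 * i) ∂κ
                ≤ (ρ ^ 2) ^ i * (β ^ (2 * i) * (∫ y, |y| ^ i ∂κ) ^ 2) :=
                  mul_le_mul_of_nonneg_left (hreg i hi) (by positivity)
              _ = (ρ ^ 2 * β ^ 2) ^ i * (∫ y, |y| ^ i ∂κ) ^ 2 := by ring
              _ = _ := by rw [hρβ]
      _ ≤ ∫ z, evenSum r a (1 ^ 2 * z.1 ^ 2) * evenSum r a (1 ^ 2 * z.2 ^ 2) ∂(κ.prod κ) := by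
          have hi : Integrable (fun y => evenSum r a (1 ^ 2 * y ^ 2)) κ := by
            simp_rw [← mul_pow, evenSum_sq]
            refine Integrable.div_const ((integrable_affine_pow hmem a 1 r).add ?_) _
            simpa [sub_eq_add_neg] using integrable_affine_pow hmem a (-1) r
          refine integral_mono (integrable_evenSum_prod hmem _ _ _) (hi.mul_prod hi) fun z => ?_
          simp only [one_pow, one_mul]
          refine le_trans ?_ (evenSum_mul_sq_le r a z.1 z.2)
          have := two_point_ineq hr a (w := |z.1| * |z.2|) (by positivity)
          rwa [show 1 / 4 * (|z.1| * |z.2|) = |z.1| * |z.2| / 4 by ring]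
      _ = _ := by rw [integral_prod_mul (fun y => evenSum r a (1 ^ 2 * y ^ 2))
                    fun y => evenSum r a (1 ^ 2 * y ^ 2), sq (∫ y, evenSum r a (1 ^ 2 * y ^ 2) ∂κ)]
  have hL : ∀ (c : ℝ) (n : ℕ), ∫⁻ y, ‖a + c * y‖ₑ ^ (2 * n) ∂κ =
      ENNReal.ofReal (∫ y, (a + c * y) ^ (2 * n) ∂κ) := by
    intro c n
    rw [ofReal_integral_eq_lintegral_ofReal (integrable_affine_pow hmem a c n)
      (Filter.Eventually.of_forall fun y => Even.pow_nonneg (even_two_mul n) _)]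
    simp_rw [enorm_pow_two_mul]
  have h1 := hL 1 r
  have h2 := hL ρ (2 * r)
  simp only [one_mul] at h1 key
  rw [show 4 * r = 2 * (2 * r) by ring, h1, h2, ← ENNReal.ofReal_pow
    (integral_nonneg fun y => Even.pow_nonneg (even_two_mul r) _)]
  exact ENNReal.ofReal_le_ofReal key

end Single

/-- Minkowski's integral inequality in L²: expand the square as a double integral, exchange the
order, and apply Cauchy–Schwarz in `y`. -/
theorem lintegral_sq_lintegral_le {β γ : Type*} [MeasurableSpace β] [MeasurableSpace γ]
    (μ : Measure β) (ν : Measure γ) [SFinite μ] [SFinite ν] {F : β → γ → ℝ≥0∞}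
    (hF : Measurable (Function.uncurry F)) :
    ∫⁻ y, (∫⁻ x, F x y ∂μ) ^ 2 ∂ν ≤ (∫⁻ x, (∫⁻ y, F x y ^ 2 ∂ν) ^ (1 / 2 : ℝ) ∂μ) ^ 2 := by
  have hx : ∀ x, Measurable (F x) := fun x => hF.comp measurable_prodMk_left
  have hy : ∀ y, Measurable fun x => F x y := fun y => hF.comp measurable_prodMk_right
  have hG : Measurable fun x => (∫⁻ y, F x y ^ 2 ∂ν) ^ (1 / 2 : ℝ) :=
    (Measurable.lintegral_prod_right' (f := fun z : β × γ => F z.1 z.2 ^ 2)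
      (hF.pow_const 2)).pow_const _
  have hsq : ∀ (m : Measure β) (g : β → ℝ≥0∞), Measurable g →
      (∫⁻ x, g x ∂m) ^ 2 = ∫⁻ x, ∫⁻ x', g x * g x' ∂m ∂m := by
    intro m g hg
    simp_rw [lintegral_const_mul _ hg]
    rw [lintegral_mul_const _ hg, sq]
  have h3 : Measurable fun q : γ × β × β => F q.2.1 q.1 * F q.2.2 q.1 :=
    (hF.comp (measurable_snd.fst.prodMk measurable_fst)).mul
      (hF.comp (measurable_snd.snd.prodMk measurable_fst))
  calc ∫⁻ y, (∫⁻ x, F x y ∂μ) ^ 2 ∂ν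
      = ∫⁻ y, ∫⁻ z, F z.1 y * F z.2 y ∂(μ.prod μ) ∂ν := by
        refine lintegral_congr fun y => ?_
        rw [hsq _ _ (hy y), lintegral_prod]
        exact (((hy y).comp measurable_fst).mul ((hy y).comp measurable_snd)).aemeasurable
    _ = ∫⁻ z, ∫⁻ y, F z.1 y * F z.2 y ∂ν ∂(μ.prod μ) :=
        lintegral_lintegral_swap h3.aemeasurable
    _ ≤ ∫⁻ z, (∫⁻ y, F z.1 y ^ 2 ∂ν) ^ (1 / 2 : ℝ) * (∫⁻ y, F z.2 y ^ 2 ∂ν) ^ (1 / 2 : ℝ)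
          ∂(μ.prod μ) := by
        refine lintegral_mono fun z => ?_
        have := ENNReal.lintegral_mul_le_Lp_mul_Lq ν Real.HolderConjugate.two_two
          (hx z.1).aemeasurable (hx z.2).aemeasurable
        simpa using this
    _ = _ := by
        rw [hsq _ _ hG, lintegral_prod]
        exact ((hG.comp measurable_fst).mul (hG.comp measurable_snd)).aemeasurable

/-- The free shift is what makes this work: the bound for `κ` is used at shift `a + ρ y`, Minkowski
swaps the two norms, and the bound for `ν` is used at shift `a + x`. -/
theorem IsHypercontractive.conv {r : ℕ} {ρ : ℝ} {κ ν : Measure ℝ} [SFinite κ] [SFinite ν]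
    (hκ : IsHypercontractive r ρ κ) (hν : IsHypercontractive r ρ ν) :
    IsHypercontractive r ρ (κ ∗ ν) := by
  intro a
  rw [Measure.lintegral_conv (by fun_prop), Measure.lintegral_conv (by fun_prop)]
  rw [lintegral_lintegral_swap (by fun_prop)]
  calc ∫⁻ y, ∫⁻ x, ‖a + ρ * (x + y)‖ₑ ^ (4 * r) ∂κ ∂ν
      ≤ ∫⁻ y, (∫⁻ x, ‖a + x + ρ * y‖ₑ ^ (2 * r) ∂κ) ^ 2 ∂ν := by
        refine lintegral_mono fun y => ?_
        have := hκ (a + ρ * y)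
        simpa only [mul_add, add_assoc, add_comm, add_left_comm] using this
    _ ≤ (∫⁻ x, (∫⁻ y, (‖a + x + ρ * y‖ₑ ^ (2 * r)) ^ 2 ∂ν) ^ (1 / 2 : ℝ) ∂κ) ^ 2 :=
        lintegral_sq_lintegral_le κ ν (F := fun x y => ‖a + x + ρ * y‖ₑ ^ (2 * r))
          (by unfold Function.uncurry; fun_prop)
    _ ≤ _ := by
        refine pow_le_pow_left' (lintegral_mono fun x => ?_) 2
        have h := hν (a + x)
        simp_rw [← pow_mul, show 2 * r * 2 = 4 * r by ring]
        refine (ENNReal.rpow_le_rpow h (by norm_num)).trans (le_of_eq ?_)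
        rw [← ENNReal.rpow_natCast, ← ENNReal.rpow_mul]
        simp [add_assoc]

theorem isHypercontractive_dirac_zero (r : ℕ) (ρ : ℝ) :
    IsHypercontractive r ρ (Measure.dirac 0) := by
  intro a
  simp [← pow_mul, show 2 * r * 2 = 4 * r by ring]

/-! ### Symmetrization by an independent copy. -/

section Symmetrization

variable {Ω : Type*} [MeasurableSpace Ω] {μ : Measure Ω}

/-- The law of `S - S'`, with `S'` an independent copy of `S`. -/
noncomputable def symLaw (μ : Measure Ω) (S : Ω → ℝ) : Measure ℝ :=
  (μ.prod μ).map fun z => S z.1 - S z.2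

theorem eLpNorm_symLaw {S : Ω → ℝ} (hS : Measurable S) (p : ℝ≥0∞) :
    eLpNorm (fun y : ℝ => y) p (symLaw μ S) =
      eLpNorm (fun z : Ω × Ω => S z.1 - S z.2) p (μ.prod μ) := by
  unfold symLaw
  rw [eLpNorm_map_measure (by fun_prop) (by fun_prop)]
  rfl

variable [IsProbabilityMeasure μ]

theorem isProbabilityMeasure_symLaw {S : Ω → ℝ} (hS : Measurable S) :
    IsProbabilityMeasure (symLaw μ S) :=
  Measure.isProbabilityMeasure_map (by fun_prop)

theorem symLaw_eq_conv {S : Ω → ℝ} (hS : Measurable S) :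
    symLaw μ S = (μ.map S) ∗ ((μ.map S).map fun y => -y) := by
  have h : IndepFun (fun z : Ω × Ω => S z.1) (fun z => -S z.2) (μ.prod μ) :=
    indepFun_prod (X := S) (Y := fun ω => -S ω) hS hS.neg
  have h2 := h.map_add_eq_map_conv_map (by fun_prop) (by fun_prop)
  have e1 : (μ.prod μ).map (fun z : Ω × Ω => S z.1) = μ.map S := by
    rw [← Function.comp_def S, ← Measure.map_map hS measurable_fst, Measure.map_fst_prod]
    simp
  have e2 : (μ.prod μ).map (fun z : Ω × Ω => -S z.2) = (μ.map S).map fun y => -y := by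
    rw [Measure.map_map (by fun_prop) hS,
      show (fun z : Ω × Ω => -S z.2) = ((fun y => -y) ∘ S) ∘ Prod.snd from rfl,
      ← Measure.map_map (by fun_prop) measurable_snd, Measure.map_snd_prod]
    simp
  rw [e1, e2] at h2
  exact h2

theorem map_neg_symLaw {S : Ω → ℝ} (hS : Measurable S) :
    (symLaw μ S).map (fun y => -y) = symLaw μ S := by
  unfold symLaw
  rw [Measure.map_map (by fun_prop) (by fun_prop)]
  conv_rhs => rw [← Measure.prod_swap, Measure.map_map (by fun_prop) (by fun_prop)]
  congr 1 with z
  simp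

theorem symLaw_add {S T : Ω → ℝ} (hS : Measurable S) (hT : Measurable T) (hST : IndepFun S T μ) :
    symLaw μ (S + T) = symLaw μ S ∗ symLaw μ T := by
  have := Measure.isProbabilityMeasure_map (μ := μ) hS.aemeasurable
  have := Measure.isProbabilityMeasure_map (μ := μ) hT.aemeasurable
  have := Measure.isProbabilityMeasure_map (μ := μ.map S) measurable_neg.aemeasurable
  have := Measure.isProbabilityMeasure_map (μ := μ.map T) measurable_neg.aemeasurable
  rw [symLaw_eq_conv (hS.add hT), symLaw_eq_conv hS, symLaw_eq_conv hT,
    hST.map_add_eq_map_conv_map hS hT]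
  have h : ((μ.map S) ∗ (μ.map T)).map (fun y => -y) =
      ((μ.map S).map fun y => -y) ∗ ((μ.map T).map fun y => -y) :=
    Measure.map_conv_addMonoidHom (negAddMonoidHom (α := ℝ)) measurable_neg
  rw [h]
  simp only [Measure.conv_assoc]
  congr 1
  rw [← Measure.conv_assoc, ← Measure.conv_assoc, Measure.conv_comm (μ.map T)]

theorem eLpNorm_symLaw_le {S : Ω → ℝ} (hS : Measurable S) {p : ℝ≥0∞} (hp : 1 ≤ p) :
    eLpNorm (fun y : ℝ => y) p (symLaw μ S) ≤ 2 * eLpNorm S p μ := by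
  rw [eLpNorm_symLaw hS]
  have h1 : eLpNorm (fun z : Ω × Ω => S z.1) p (μ.prod μ) = eLpNorm S p μ :=
    eLpNorm_comp_measurePreserving hS.aestronglyMeasurable measurePreserving_fst
  have h2 : eLpNorm (fun z : Ω × Ω => S z.2) p (μ.prod μ) = eLpNorm S p μ :=
    eLpNorm_comp_measurePreserving hS.aestronglyMeasurable measurePreserving_snd
  refine (eLpNorm_sub_le (f := fun z : Ω × Ω => S z.1) (g := fun z : Ω × Ω => S z.2)
    (hS.comp measurable_fst).aestronglyMeasurable (hS.comp measurable_snd).aestronglyMeasurable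
    hp).trans ?_
  rw [h1, h2, two_mul]

/-- Jensen's inequality: as the mean is zero, `S ω` is the average of `S ω - S ω'` over `ω'`. -/
theorem eLpNorm_le_eLpNorm_symLaw {S : Ω → ℝ} (hS : Measurable S) (hint : Integrable S μ)
    (h0 : ∫ ω, S ω ∂μ = 0) {p : ℝ≥0∞} (hp : 1 ≤ p) (hp' : p ≠ ⊤) :
    eLpNorm S p μ ≤ eLpNorm (fun y : ℝ => y) p (symLaw μ S) := by
  have hp0 : p ≠ 0 := (zero_lt_one.trans_le hp).ne'
  have hpr : 0 < p.toReal := ENNReal.toReal_pos hp0 hp'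
  rw [eLpNorm_symLaw hS, eLpNorm_eq_lintegral_rpow_enorm_toReal hp0 hp',
    eLpNorm_eq_lintegral_rpow_enorm_toReal hp0 hp']
  refine ENNReal.rpow_le_rpow ?_ (by positivity)
  rw [lintegral_prod _ (by fun_prop)]
  refine lintegral_mono fun ω => ?_
  have h1 : ‖S ω‖ₑ ≤ eLpNorm (fun ω' => S ω - S ω') 1 μ := by
    have : S ω = ∫ ω', (S ω - S ω') ∂μ := by
      rw [integral_sub (integrable_const _) hint, h0]
      simp
    rw [eLpNorm_one_eq_lintegral_enorm]
    conv_lhs => rw [this]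
    exact enorm_integral_le_lintegral_enorm _
  have h2 := h1.trans (eLpNorm_le_eLpNorm_of_exponent_le hp
    (measurable_const.sub hS).aestronglyMeasurable)
  rw [eLpNorm_eq_lintegral_rpow_enorm_toReal hp0 hp'] at h2
  refine (ENNReal.rpow_le_rpow h2 hpr.le).trans (le_of_eq ?_)
  rw [← ENNReal.rpow_mul, one_div, inv_mul_cancel₀ hpr.ne', ENNReal.rpow_one]

end Symmetrization

theorem eLpNorm_natCast_pow {Ω : Type*} [MeasurableSpace Ω] {μ : Measure Ω} {S : Ω → ℝ} {l : ℕ} (hl : 1 ≤ l) :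
    eLpNorm S l μ ^ l = ∫⁻ ω, ‖S ω‖ₑ ^ l ∂μ := by
  have h1 := eLpNorm_nnreal_pow_eq_lintegral (μ := μ) (f := S)
    (p := (l : ℝ≥0)) (by exact_mod_cast (by omega : l ≠ 0))
  simpa only [NNReal.coe_natCast, ENNReal.rpow_natCast, ENNReal.coe_natCast] using h1

/-! ### Moment growth of sums of independent regular variables. -/

section Regular

variable {Ω : Type*} [MeasurableSpace Ω] {μ : Measure Ω}

/-- `‖S‖_{2p} ≤ α ‖S‖_p` for all real `p ≥ 1`. -/
def HasRegularMoments (μ : Measure Ω) (α : ℝ) (S : Ω → ℝ) : Prop :=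
  ∀ p : ℝ, 1 ≤ p →
    eLpNorm S (ENNReal.ofReal (2 * p)) μ ≤ ENNReal.ofReal α * eLpNorm S (ENNReal.ofReal p) μ

theorem HasRegularMoments.const_mul {α : ℝ} {S : Ω → ℝ} (h : HasRegularMoments μ α S) (c : ℝ) :
    HasRegularMoments μ α fun ω => c * S ω := by
  intro p hp
  have e : (fun ω => c * S ω) = c • S := rfl
  rw [e, eLpNorm_const_smul, eLpNorm_const_smul, mul_left_comm]
  gcongr
  exact h p hp

theorem HasRegularMoments.nat {α : ℝ} {S : Ω → ℝ} (h : HasRegularMoments μ α S) {l : ℕ}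
    (hl : 1 ≤ l) :
    eLpNorm S (2 * l : ℕ) μ ≤ ENNReal.ofReal α * eLpNorm S (l : ℕ) μ := by
  have := h l (by exact_mod_cast hl)
  rw [show (2 * l : ℝ) = ((2 * l : ℕ) : ℝ) by push_cast; ring] at this
  simpa only [ENNReal.ofReal_natCast] using this

variable [IsProbabilityMeasure μ]

/-- Doubling the exponent from 1 shows that all moments are finite. -/
theorem HasRegularMoments.memLp {α : ℝ} {S : Ω → ℝ} (h : HasRegularMoments μ α S)
    (hint : Integrable S μ) (p : ℕ) : MemLp S p μ := by
  have h2 : ∀ m : ℕ, MemLp S (2 ^ m : ℕ) μ := by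
    intro m
    induction m with
    | zero => simpa using memLp_one_iff_integrable.2 hint
    | succ m ih =>
      refine ⟨hint.aestronglyMeasurable, ?_⟩
      rw [pow_succ']
      exact (h.nat Nat.one_le_two_pow).trans_lt (ENNReal.mul_lt_top ENNReal.ofReal_lt_top ih.2)
  exact (h2 p).mono_exponent (by exact_mod_cast Nat.lt_two_pow_self.le)

theorem ofReal_integral_abs_pow {κ : Measure ℝ} {l : ℕ} (hl : 1 ≤ l)
    (h : Integrable (fun y : ℝ => |y| ^ l) κ) :
    ENNReal.ofReal (∫ y, |y| ^ l ∂κ) = eLpNorm (fun y : ℝ => y) l κ ^ l := by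
  rw [eLpNorm_natCast_pow hl, ofReal_integral_eq_lintegral_ofReal h (Filter.Eventually.of_forall fun y => by positivity)]
  refine lintegral_congr fun y => ?_
  rw [Real.enorm_eq_ofReal_abs, ENNReal.ofReal_pow (abs_nonneg y)]

/-- Symmetrizing costs a factor 2 at the upper exponent and nothing at the lower, so the symmetrized
law is regular with `β = 2α`. -/
theorem HasRegularMoments.isHypercontractive_symLaw {α : ℝ} (hα : 1 ≤ α) {S : Ω → ℝ}
    (hS : Measurable S) (hint : Integrable S μ) (h0 : ∫ ω, S ω ∂μ = 0)
    (h : HasRegularMoments μ α S) {r : ℕ} (hr : 1 ≤ r) :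
    IsHypercontractive r (1 / (2 * (2 * α))) (symLaw μ S) := by
  have := isProbabilityMeasure_symLaw (μ := μ) hS
  have hmem : ∀ p : ℕ, MemLp (fun y : ℝ => y) p (symLaw μ S) := by
    intro p
    have h1 : MemLp (fun y : ℝ => y) (p + 1 : ℕ) (symLaw μ S) := by
      refine ⟨by fun_prop, ?_⟩
      exact (eLpNorm_symLaw_le hS (by exact_mod_cast (by omega : 1 ≤ p + 1))).trans_lt
        (ENNReal.mul_lt_top (by simp) (h.memLp hint _).2)
    exact h1.mono_exponent (by exact_mod_cast p.le_succ)
  refine isHypercontractive_of_symm hmem (map_neg_symLaw hS) (by positivity) (fun l hl => ?_) hr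
  have hl' : (1 : ℝ≥0∞) ≤ (l : ℕ) := by exact_mod_cast hl
  have h2l : (1 : ℝ≥0∞) ≤ (2 * l : ℕ) := by exact_mod_cast (by omega : 1 ≤ 2 * l)
  have hE : eLpNorm (fun y : ℝ => y) (2 * l : ℕ) (symLaw μ S) ≤
      ENNReal.ofReal (2 * α) * eLpNorm (fun y : ℝ => y) l (symLaw μ S) := by
    refine (eLpNorm_symLaw_le hS h2l).trans ?_
    rw [ENNReal.ofReal_mul (by norm_num), ENNReal.ofReal_ofNat, mul_assoc]
    refine mul_le_mul_right ((h.nat hl).trans (mul_le_mul_right ?_ _)) _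
    exact eLpNorm_le_eLpNorm_symLaw hS hint h0 hl' (by simp)
  have hpow := pow_le_pow_left' hE (2 * l)
  rw [mul_pow, mul_comm 2 l, pow_mul (eLpNorm _ (l : ℝ≥0∞) _), mul_comm l 2,
    ← ofReal_integral_abs_pow (by omega) (integrable_abs_pow hmem _),
    ← ofReal_integral_abs_pow hl (integrable_abs_pow hmem _),
    ← ENNReal.ofReal_pow (by positivity), ← ENNReal.ofReal_pow (by positivity),
    ← ENNReal.ofReal_mul (by positivity)] at hpow
  exact (ENNReal.ofReal_le_ofReal_iff (by positivity)).1 hpow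

variable {ι : Type*} {X : ι → Ω → ℝ} {α : ℝ}

theorem isHypercontractive_symLaw_sum (hα : 1 ≤ α) (hX : ∀ q, Measurable (X q))
    (hind : iIndepFun X μ) (hint : ∀ q, Integrable (X q) μ) (h0 : ∀ q, ∫ ω, X q ω ∂μ = 0)
    (hreg : ∀ q, HasRegularMoments μ α (X q)) (c : ι → ℝ) (s : Finset ι) {r : ℕ} (hr : 1 ≤ r) :
    IsHypercontractive r (1 / (2 * (2 * α))) (symLaw μ (∑ q ∈ s, fun ω => c q * X q ω)) := by
  classical
  have hind' : iIndepFun (fun q ω => c q * X q ω) μ :=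
    hind.comp (fun q x => c q * x) fun q => by fun_prop
  have hm : ∀ q, Measurable fun ω => c q * X q ω := fun q => (hX q).const_mul _
  induction s using Finset.induction_on with
  | empty =>
    have : symLaw μ (0 : Ω → ℝ) = Measure.dirac 0 := by
      unfold symLaw
      simp
    rw [Finset.sum_empty, this]
    exact isHypercontractive_dirac_zero _ _
  | insert q s hq ih =>
    have hms : Measurable (∑ q ∈ s, fun ω => c q * X q ω) := by
      rw [Finset.sum_fn]
      exact Finset.measurable_fun_sum _ fun q _ => hm q
    rw [Finset.sum_insert hq, symLaw_add (hm q) hms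
      (hind'.indepFun_finsetSum_of_notMem hm hq).symm]
    have := isProbabilityMeasure_symLaw (μ := μ) (hm q)
    have := isProbabilityMeasure_symLaw (μ := μ) hms
    refine IsHypercontractive.conv ?_ ih
    exact ((hreg q).const_mul (c q)).isHypercontractive_symLaw hα (hm q) ((hint q).const_mul _)
      (by rw [integral_const_mul, h0, mul_zero]) hr

theorem eLpNorm_sum_le (hα : 1 ≤ α) (hX : ∀ q, Measurable (X q))
    (hind : iIndepFun X μ) (hint : ∀ q, Integrable (X q) μ) (h0 : ∀ q, ∫ ω, X q ω ∂μ = 0)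
    (hreg : ∀ q, HasRegularMoments μ α (X q)) (c : ι → ℝ) (s : Finset ι) {r : ℕ} (hr : 1 ≤ r) :
    eLpNorm (fun ω => ∑ q ∈ s, c q * X q ω) (4 * r : ℕ) μ ≤
      ENNReal.ofReal (8 * α) * eLpNorm (fun ω => ∑ q ∈ s, c q * X q ω) (2 * r : ℕ) μ := by
  have hS : (fun ω => ∑ q ∈ s, c q * X q ω) = ∑ q ∈ s, fun ω => c q * X q ω := by
    ext ω; simp
  have hm : ∀ q, Measurable fun ω => c q * X q ω := fun q => (hX q).const_mul _
  have hms : Measurable (∑ q ∈ s, fun ω => c q * X q ω) := by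
    rw [Finset.sum_fn]
    exact Finset.measurable_fun_sum _ fun q _ => hm q
  have hin : Integrable (∑ q ∈ s, fun ω => c q * X q ω) μ :=
    integrable_finsetSum' _ fun q _ => (hint q).const_mul _
  have hz : ∫ ω, (∑ q ∈ s, fun ω => c q * X q ω) ω ∂μ = 0 := by
    rw [← hS, integral_finsetSum _ fun q _ => (hint q).const_mul _]
    exact Finset.sum_eq_zero fun q _ => by rw [integral_const_mul, h0, mul_zero]
  rw [hS]
  -- The shift has served its purpose in the convolution; at shift 0 the inequality compares two
  -- moments. The factor `4α = 1/ρ` and a further 2 for undoing the symmetrization give `8α`.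
  have hc := isHypercontractive_symLaw_sum hα hX hind hint h0 hreg c s hr 0
  set S := ∑ q ∈ s, fun ω => c q * X q ω
  set ρ := 1 / (2 * (2 * α)) with hρ
  have hρ0 : 0 < ρ := by positivity
  simp only [zero_add, enorm_mul, mul_pow] at hc
  rw [lintegral_const_mul _ (by fun_prop), ← eLpNorm_natCast_pow (by omega),
    ← eLpNorm_natCast_pow (by omega), ← mul_pow,
    ← pow_mul, show 2 * r * 2 = 4 * r by ring] at hc
  have hc' := (ENNReal.pow_le_pow_left_iff (by omega : 4 * r ≠ 0)).1 hc
  have h1 : eLpNorm S (4 * r : ℕ) μ ≤ eLpNorm (fun y : ℝ => y) (4 * r : ℕ) (symLaw μ S) :=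
    eLpNorm_le_eLpNorm_symLaw hms hin hz (by exact_mod_cast (by omega : 1 ≤ 4 * r))
      (ENNReal.natCast_ne_top _)
  have h2 : eLpNorm (fun y : ℝ => y) (2 * r : ℕ) (symLaw μ S) ≤ 2 * eLpNorm S (2 * r : ℕ) μ :=
    eLpNorm_symLaw_le hms (by exact_mod_cast (by omega : 1 ≤ 2 * r))
  have e : ENNReal.ofReal (4 * α) * ‖ρ‖ₑ = 1 := by
    rw [Real.enorm_eq_ofReal hρ0.le, ← ENNReal.ofReal_mul (by positivity), hρ,
      ← ENNReal.ofReal_one]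
    congr 1
    field_simp
    norm_num
  calc eLpNorm S (4 * r : ℕ) μ
      ≤ ENNReal.ofReal (4 * α) * ‖ρ‖ₑ * eLpNorm (fun y : ℝ => y) (4 * r : ℕ) (symLaw μ S) := by
        rw [e, one_mul]; exact h1
    _ ≤ ENNReal.ofReal (4 * α) * (2 * eLpNorm S (2 * r : ℕ) μ) := by
        rw [mul_assoc]
        exact mul_le_mul_right (hc'.trans h2) _
    _ = _ := by
        rw [← mul_assoc, ← ENNReal.ofReal_ofNat 2, ← ENNReal.ofReal_mul (by positivity)]
        congr 2
        ring

theorem eLpNorm_sum_two_pow_le (hα : 1 ≤ α) (hX : ∀ q, Measurable (X q))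
    (hind : iIndepFun X μ) (hint : ∀ q, Integrable (X q) μ) (h0 : ∀ q, ∫ ω, X q ω ∂μ = 0)
    (hreg : ∀ q, HasRegularMoments μ α (X q)) (c : ι → ℝ) (s : Finset ι) {m : ℕ} (hm : 1 ≤ m)
    (d : ℕ) :
    eLpNorm (fun ω => ∑ q ∈ s, c q * X q ω) (2 ^ (m + d) : ℕ) μ ≤
      ENNReal.ofReal (8 * α) ^ d * eLpNorm (fun ω => ∑ q ∈ s, c q * X q ω) (2 ^ m : ℕ) μ := by
  induction d with
  | zero => simp
  | succ d ih =>
    -- Since `m ≥ 1`, the lower exponent has the even form `2 * r`.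
    obtain ⟨k, rfl⟩ := Nat.exists_eq_add_of_le' hm
    have := eLpNorm_sum_le hα hX hind hint h0 hreg c s (r := 2 ^ (k + d)) Nat.one_le_two_pow
    rw [show 4 * 2 ^ (k + d) = 2 ^ (k + 1 + (d + 1)) by ring,
      show 2 * 2 ^ (k + d) = 2 ^ (k + 1 + d) by ring] at this
    refine this.trans ((mul_le_mul_right ih _).trans (le_of_eq ?_))
    ring

end Regular

/-! ### Bilinear forms: row, column and second-moment bounds. -/

section BilinearForm

variable {n : ℕ}

theorem abs_sum_mul_le_norm_toEuclideanCLM (x : Fin n → Fin n → ℝ) (s t : Fin n → ℝ) :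
    |∑ q : Fin n × Fin n, s q.1 * t q.2 * x q.1 q.2| ≤
      ‖Matrix.toEuclideanCLM (n := Fin n) (𝕜 := ℝ) (Matrix.of fun i j => x i j)‖ *
        (√(∑ i, s i ^ 2) * √(∑ j, t j ^ 2)) := by
  set A := Matrix.toEuclideanCLM (n := Fin n) (𝕜 := ℝ) (Matrix.of fun i j => x i j) with hA
  have h1 : inner ℝ (WithLp.toLp 2 s) (A (WithLp.toLp 2 t)) =
      ∑ q : Fin n × Fin n, s q.1 * t q.2 * x q.1 q.2 := by
    rw [hA, Matrix.toEuclideanCLM_toLp, Fintype.sum_prod_type]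
    simp only [PiLp.inner_apply, Matrix.mulVec, dotProduct, Matrix.of_apply]
    refine Finset.sum_congr rfl fun i _ => ?_
    simp only [RCLike.inner_apply, conj_trivial, Finset.sum_mul]
    refine Finset.sum_congr rfl fun j _ => by ring
  have h2 : ∀ u : Fin n → ℝ, ‖WithLp.toLp 2 u‖ = √(∑ i, u i ^ 2) := fun u => by
    simp [EuclideanSpace.norm_eq]
  rw [← h1, ← h2, ← h2]
  refine (abs_real_inner_le_norm _ _).trans ?_
  have h3 := A.le_opNorm (WithLp.toLp 2 t)
  have := mul_le_mul_of_nonneg_left h3 (norm_nonneg (WithLp.toLp 2 s))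
  linarith

variable {Ω : Type*}

/-- The random bilinear form `∑_{i,j} X_ij s_i t_j`. -/
noncomputable def bilinForm (X : Fin n → Fin n → Ω → ℝ) (s t : Fin n → ℝ) (ω : Ω) : ℝ :=
  ∑ q : Fin n × Fin n, s q.1 * t q.2 * X q.1 q.2 ω

theorem enorm_bilinForm_le (X : Fin n → Fin n → Ω → ℝ) (s t : Fin n → ℝ) (ω : Ω) :
    ‖bilinForm X s t ω‖ₑ ≤ ENNReal.ofReal (√(∑ i, s i ^ 2) * √(∑ j, t j ^ 2)) *
      ‖Matrix.toEuclideanCLM (n := Fin n) (𝕜 := ℝ) (Matrix.of fun i j => X i j ω)‖ₑ := by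
  have h := abs_sum_mul_le_norm_toEuclideanCLM (fun i j => X i j ω) s t
  rw [← ofReal_norm, ← ofReal_norm, ← ENNReal.ofReal_mul (by positivity),
    mul_comm _ ‖_‖]
  exact ENNReal.ofReal_le_ofReal h

theorem bilinForm_add_left (X : Fin n → Fin n → Ω → ℝ) (s s' t : Fin n → ℝ) :
    bilinForm X (s + s') t = bilinForm X s t + bilinForm X s' t := by
  ext ω
  simp only [bilinForm, Pi.add_apply, ← Finset.sum_add_distrib]
  exact Finset.sum_congr rfl fun q _ => by ring

theorem bilinForm_add_right (X : Fin n → Fin n → Ω → ℝ) (s t t' : Fin n → ℝ) :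
    bilinForm X s (t + t') = bilinForm X s t + bilinForm X s t' := by
  ext ω
  simp only [bilinForm, Pi.add_apply, ← Finset.sum_add_distrib]
  exact Finset.sum_congr rfl fun q _ => by ring

variable [MeasurableSpace Ω] {μ : Measure Ω}

theorem measurable_bilinForm {X : Fin n → Fin n → Ω → ℝ} (hX : ∀ i j, Measurable (X i j))
    (s t : Fin n → ℝ) : Measurable (bilinForm X s t) := by
  unfold bilinForm
  fun_prop

/-- Here `g` stands for the operator norm, seen from one row or column. As `c` may depend on `ω`, it
is chosen to align the signs of all the terms; no independence is needed. -/
theorem sqrt_sum_second_moment_le {α : ℝ} {Y : Fin n → Ω → ℝ}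
    (hint : ∀ j, Integrable (Y j) μ) (hreg : ∀ j, HasRegularMoments μ α (Y j)) {g : Ω → ℝ≥0∞}
    (hg : ∀ (c : Fin n → ℝ) ω, ‖∑ j, c j * Y j ω‖ₑ ≤ ENNReal.ofReal √(∑ j, c j ^ 2) * g ω) :
    (∑ j, ∫⁻ ω, ENNReal.ofReal (Y j ω ^ 2) ∂μ) ^ (1 / 2 : ℝ) ≤ ENNReal.ofReal α * ∫⁻ ω, g ω ∂μ := by
  set e : Fin n → ℝ := fun j => ∫ ω, |Y j ω| ∂μ with he
  have he0 : ∀ j, 0 ≤ e j := fun j => integral_nonneg fun ω => abs_nonneg _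
  set D := ∑ j, e j ^ 2 with hD
  have hD0 : 0 ≤ D := Finset.sum_nonneg fun j _ => sq_nonneg _
  have h1 : ENNReal.ofReal D ≤ ENNReal.ofReal √D * ∫⁻ ω, g ω ∂μ := by
    rcases hD0.eq_or_lt with h | h
    · simp [← h]
    have hp : ∀ ω, ENNReal.ofReal (∑ j, e j * |Y j ω|) ≤ ENNReal.ofReal √D * g ω := by
      intro ω
      -- With `c j = e j * sign (Y j ω)` the sum has mean `D`, while the norm of `c` is at most
      -- `√D`.
      have h2 := hg (fun j => e j * SignType.sign (Y j ω)) ω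
      have h3 : ∑ j, e j * (SignType.sign (Y j ω) : ℝ) * Y j ω = ∑ j, e j * |Y j ω| :=
        Finset.sum_congr rfl fun j _ => by rw [mul_assoc, sign_mul_self]
      have h4 : ∑ j, (e j * (SignType.sign (Y j ω) : ℝ)) ^ 2 ≤ D := by
        refine Finset.sum_le_sum fun j _ => ?_
        rw [mul_pow]
        refine mul_le_of_le_one_right (sq_nonneg _) ?_
        cases SignType.sign (Y j ω) <;> simp
      rw [h3, Real.enorm_eq_ofReal (Finset.sum_nonneg fun j _ =>
        mul_nonneg (he0 j) (abs_nonneg _))] at h2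
      exact h2.trans (mul_le_mul_left (ENNReal.ofReal_le_ofReal (Real.sqrt_le_sqrt h4)) _)
    have h5 : ∫ ω, ∑ j, e j * |Y j ω| ∂μ = D := by
      rw [integral_finsetSum _ fun j _ => (hint j).abs.const_mul _]
      exact Finset.sum_congr rfl fun j _ => by rw [integral_const_mul, sq]
    rw [← lintegral_const_mul' _ _ ENNReal.ofReal_ne_top]
    conv_lhs => rw [← h5]
    rw [ofReal_integral_eq_lintegral_ofReal (integrable_finsetSum _ fun j _ =>
      (hint j).abs.const_mul _) (Filter.Eventually.of_forall fun ω =>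
        Finset.sum_nonneg fun j _ => mul_nonneg (he0 j) (abs_nonneg _))]
    exact lintegral_mono hp
  have h2 : ENNReal.ofReal √D ≤ ∫⁻ ω, g ω ∂μ := by
    rcases hD0.eq_or_lt with h | h
    · simp [← h]
    · have h3 : ENNReal.ofReal √D ≠ 0 := by simpa using h
      rw [← Real.mul_self_sqrt hD0, ENNReal.ofReal_mul (Real.sqrt_nonneg _),
        Real.mul_self_sqrt hD0] at h1
      exact (ENNReal.mul_le_mul_iff_right h3 ENNReal.ofReal_ne_top).1 h1
  have h3 : ∀ j, ∫⁻ ω, ENNReal.ofReal (Y j ω ^ 2) ∂μ ≤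
      ENNReal.ofReal α ^ 2 * ENNReal.ofReal (e j ^ 2) := by
    intro j
    have h4 := hreg j 1 le_rfl
    have h5 := eLpNorm_nnreal_pow_eq_lintegral (μ := μ) (f := Y j) (p := 2) (by norm_num)
    have h6 : ∫⁻ ω, ENNReal.ofReal (Y j ω ^ 2) ∂μ = eLpNorm (Y j) 2 μ ^ 2 := by
      simp only [NNReal.coe_ofNat, ENNReal.coe_ofNat, ENNReal.rpow_ofNat] at h5
      rw [h5]
      refine lintegral_congr fun ω => ?_
      exact (enorm_pow_two_mul (Y j ω) 1).symm
    rw [h6, ENNReal.ofReal_pow (he0 j), ← mul_pow]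
    refine pow_le_pow_left' ?_ 2
    simp only [mul_one, ENNReal.ofReal_ofNat, ENNReal.ofReal_one] at h4
    rw [eLpNorm_one_eq_lintegral_enorm, ← ofReal_integral_norm_eq_lintegral_enorm (hint j)] at h4
    exact h4
  calc (∑ j, ∫⁻ ω, ENNReal.ofReal (Y j ω ^ 2) ∂μ) ^ (1 / 2 : ℝ)
      ≤ (∑ j, ENNReal.ofReal α ^ 2 * ENNReal.ofReal (e j ^ 2)) ^ (1 / 2 : ℝ) :=
        ENNReal.rpow_le_rpow (Finset.sum_le_sum fun j _ => h3 j) (by norm_num)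
    _ = ((ENNReal.ofReal α * ENNReal.ofReal √D) ^ 2) ^ (1 / 2 : ℝ) := by
        rw [← Finset.mul_sum, ← ENNReal.ofReal_sum_of_nonneg fun j _ => sq_nonneg _, mul_pow,
          ← ENNReal.ofReal_pow (Real.sqrt_nonneg _), Real.sq_sqrt hD0]
    _ = ENNReal.ofReal α * ENNReal.ofReal √D := by
        rw [← ENNReal.rpow_natCast, ← ENNReal.rpow_mul]
        norm_num
    _ ≤ _ := mul_le_mul_right h2 _

variable {α : ℝ} {X : Fin n → Fin n → Ω → ℝ}

theorem sum_single_mul_bilin (x : Fin n → Fin n → ℝ) (i : Fin n) (c : Fin n → ℝ) :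
    ∑ q : Fin n × Fin n, (Pi.single i 1 : Fin n → ℝ) q.1 * c q.2 * x q.1 q.2 =
      ∑ j, c j * x i j := by
  rw [Fintype.sum_prod_type, Finset.sum_eq_single i]
  · simp
  · intro k _ hk
    simp [hk]
  · simp

theorem sum_single_sq (i : Fin n) : ∑ k, (Pi.single i 1 : Fin n → ℝ) k ^ 2 = 1 := by
  rw [Finset.sum_eq_single i] <;> simp +contextual

theorem row_second_moment_le (hint : ∀ i j, Integrable (X i j) μ)
    (hreg : ∀ i j, HasRegularMoments μ α (X i j)) (i : Fin n) :
    (∑ j, ∫⁻ ω, ENNReal.ofReal (X i j ω ^ 2) ∂μ) ^ (1 / 2 : ℝ) ≤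
      ENNReal.ofReal α * expOpNorm μ X := by
  refine sqrt_sum_second_moment_le (hint i) (hreg i) fun c ω => ?_
  have h := enorm_bilinForm_le X (Pi.single i 1) c ω
  rw [sum_single_sq, Real.sqrt_one, one_mul, bilinForm,
    sum_single_mul_bilin (fun i j => X i j ω)] at h
  exact h

theorem col_second_moment_le (hint : ∀ i j, Integrable (X i j) μ)
    (hreg : ∀ i j, HasRegularMoments μ α (X i j)) (j : Fin n) :
    (∑ i, ∫⁻ ω, ENNReal.ofReal (X i j ω ^ 2) ∂μ) ^ (1 / 2 : ℝ) ≤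
      ENNReal.ofReal α * expOpNorm μ X := by
  refine sqrt_sum_second_moment_le (fun i => hint i j) (fun i => hreg i j) fun c ω => ?_
  have h := enorm_bilinForm_le X c (Pi.single j 1) ω
  rw [sum_single_sq, Real.sqrt_one, mul_one, bilinForm, ← (Equiv.prodComm _ _).sum_comp] at h
  simp only [Equiv.prodComm_apply, Prod.fst_swap, Prod.snd_swap, mul_comm (c _)] at h
  rw [sum_single_mul_bilin (fun k i => X i k ω)] at h
  exact h

theorem maxRow_le (hint : ∀ i j, Integrable (X i j) μ)
    (hreg : ∀ i j, HasRegularMoments μ α (X i j)) :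
    maxRow μ X ≤ ENNReal.ofReal α * expOpNorm μ X :=
  iSup_le fun i => row_second_moment_le hint hreg i

theorem maxCol_le (hint : ∀ i j, Integrable (X i j) μ)
    (hreg : ∀ i j, HasRegularMoments μ α (X i j)) :
    maxCol μ X ≤ ENNReal.ofReal α * expOpNorm μ X :=
  iSup_le fun j => col_second_moment_le hint hreg j

variable [IsProbabilityMeasure μ]

theorem eLpNorm_two_sum_sq {ι : Type*} {Y : ι → Ω → ℝ} (hind : iIndepFun Y μ)
    (hmem : ∀ q, MemLp (Y q) 2 μ) (h0 : ∀ q, ∫ ω, Y q ω ∂μ = 0) (c : ι → ℝ) (s : Finset ι) :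
    eLpNorm (fun ω => ∑ q ∈ s, c q * Y q ω) 2 μ ^ 2 =
      ∑ q ∈ s, ENNReal.ofReal (c q ^ 2) * ∫⁻ ω, ENNReal.ofReal (Y q ω ^ 2) ∂μ := by
  have hS : (fun ω => ∑ q ∈ s, c q * Y q ω) = ∑ q ∈ s, fun ω => c q * Y q ω := by
    ext ω; simp
  have hm : ∀ q, MemLp (fun ω => c q * Y q ω) 2 μ := fun q => (hmem q).const_mul _
  have hz : ∀ q, ∫ ω, c q * Y q ω ∂μ = 0 := fun q => by rw [integral_const_mul, h0, mul_zero]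
  have hind' : iIndepFun (fun q ω => c q * Y q ω) μ :=
    hind.comp (fun q x => c q * x) fun q => by fun_prop
  have hSm : MemLp (fun ω => ∑ q ∈ s, c q * Y q ω) 2 μ := memLp_finsetSum _ fun q _ => hm q
  have hvar := IndepFun.variance_sum (s := s) (fun q _ => hm q)
    (fun q _ q' _ hqq => hind'.indepFun hqq)
  rw [← hS, variance_of_integral_eq_zero hSm.aemeasurable (by
    rw [integral_finsetSum _ fun q _ => (hm q).integrable (by norm_num)]
    exact Finset.sum_eq_zero fun q _ => hz q)] at hvar
  have hconv : ∀ Z : Ω → ℝ, MemLp Z 2 μ →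
      ∫⁻ ω, ENNReal.ofReal (Z ω ^ 2) ∂μ = ENNReal.ofReal (∫ ω, Z ω ^ 2 ∂μ) := fun Z hZ =>
    (ofReal_integral_eq_lintegral_ofReal hZ.integrable_sq
      (Filter.Eventually.of_forall fun ω => sq_nonneg _)).symm
  have h5 := eLpNorm_nnreal_pow_eq_lintegral (μ := μ) (f := fun ω => ∑ q ∈ s, c q * Y q ω) (p := 2)
    (by norm_num)
  simp only [NNReal.coe_ofNat, ENNReal.coe_ofNat, ENNReal.rpow_ofNat] at h5
  rw [h5, lintegral_congr fun ω => enorm_pow_two_mul _ 1, hconv _ hSm, hvar,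
    ENNReal.ofReal_sum_of_nonneg fun q _ => variance_nonneg _ _]
  refine Finset.sum_congr rfl fun q _ => ?_
  rw [hconv _ (hmem q), variance_of_integral_eq_zero (hm q).aemeasurable (hz q),
    ← ENNReal.ofReal_mul (sq_nonneg _), ← integral_const_mul]
  simp_rw [mul_pow]

/-- Hypotheses on the random matrix. -/
structure IsRegularMatrix (μ : Measure Ω) (α : ℝ) (X : Fin n → Fin n → Ω → ℝ) : Prop where
  measurable : ∀ i j, Measurable (X i j)
  indep : iIndepFun (fun q : Fin n × Fin n => X q.1 q.2) μ
  integrable : ∀ i j, Integrable (X i j) μ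
  integral_eq_zero : ∀ i j, ∫ ω, X i j ω ∂μ = 0
  regular : ∀ i j, HasRegularMoments μ α (X i j)

theorem IsRegularMatrix.eLpNorm_two_bilinForm_sq (h : IsRegularMatrix μ α X) (s t : Fin n → ℝ) :
    eLpNorm (bilinForm X s t) 2 μ ^ 2 = ∑ q : Fin n × Fin n, ENNReal.ofReal ((s q.1 * t q.2) ^ 2) *
      ∫⁻ ω, ENNReal.ofReal (X q.1 q.2 ω ^ 2) ∂μ := by
  have hmem : ∀ q : Fin n × Fin n, MemLp (X q.1 q.2) 2 μ := fun q =>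
    (h.regular q.1 q.2).memLp (h.integrable q.1 q.2) 2
  exact eLpNorm_two_sum_sq (Y := fun q : Fin n × Fin n => X q.1 q.2) h.indep hmem
    (fun q => h.integral_eq_zero q.1 q.2) (fun q => s q.1 * t q.2) Finset.univ

theorem IsRegularMatrix.eLpNorm_two_pow_bilinForm_le (hα : 1 ≤ α) (h : IsRegularMatrix μ α X)
    (s t : Fin n → ℝ) {m : ℕ} (hm : 1 ≤ m) (d : ℕ) :
    eLpNorm (bilinForm X s t) (2 ^ (m + d) : ℕ) μ ≤
      ENNReal.ofReal (8 * α) ^ d * eLpNorm (bilinForm X s t) (2 ^ m : ℕ) μ :=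
  eLpNorm_sum_two_pow_le (X := fun q : Fin n × Fin n => X q.1 q.2) hα
    (fun q => h.measurable q.1 q.2) h.indep
    (fun q => h.integrable q.1 q.2) (fun q => h.integral_eq_zero q.1 q.2)
    (fun q => h.regular q.1 q.2) (fun q => s q.1 * t q.2) Finset.univ hm d

/-- It suffices that one of the two vectors is flat: its squares are bounded by `τ²`, the inner sums
by `b²`, and the other vector has norm at most 1. -/
theorem sum_weighted_le {b : ℝ≥0∞} {v : Fin n → Fin n → ℝ≥0∞} {τ : ℝ} {s t : Fin n → ℝ}
    (hv : ∀ j, (∑ i, v i j) ^ (1 / 2 : ℝ) ≤ b) (hs : ∀ i, |s i| ≤ τ) (ht : ∑ j, t j ^ 2 ≤ 1) :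
    ∑ j, ∑ i, ENNReal.ofReal ((s i * t j) ^ 2) * v i j ≤ (ENNReal.ofReal τ * b) ^ 2 := by
  have hv' : ∀ j, ∑ i, v i j ≤ b ^ 2 := fun j => by
    have := pow_le_pow_left' (hv j) 2
    rw [← ENNReal.rpow_natCast, ← ENNReal.rpow_mul] at this
    simpa using this
  calc ∑ j, ∑ i, ENNReal.ofReal ((s i * t j) ^ 2) * v i j
      ≤ ∑ j, ∑ i, ENNReal.ofReal τ ^ 2 * (ENNReal.ofReal (t j ^ 2) * v i j) := by
        refine Finset.sum_le_sum fun j _ => Finset.sum_le_sum fun i _ => ?_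
        have hτ : 0 ≤ τ := (abs_nonneg _).trans (hs i)
        rw [← mul_assoc, mul_pow, ENNReal.ofReal_mul (sq_nonneg _), ← ENNReal.ofReal_pow hτ]
        gcongr ?_ * _ * _
        exact ENNReal.ofReal_le_ofReal (sq_le_sq' (abs_le.1 (hs i)).1 (abs_le.1 (hs i)).2)
    _ = ENNReal.ofReal τ ^ 2 * ∑ j, ENNReal.ofReal (t j ^ 2) * ∑ i, v i j := by
        simp_rw [Finset.mul_sum]
    _ ≤ ENNReal.ofReal τ ^ 2 * ∑ j, ENNReal.ofReal (t j ^ 2) * b ^ 2 := by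
        gcongr with j
        exact hv' j
    _ ≤ ENNReal.ofReal τ ^ 2 * (1 * b ^ 2) := by
        rw [← Finset.sum_mul, ← ENNReal.ofReal_sum_of_nonneg fun j _ => sq_nonneg _]
        gcongr
        exact ENNReal.ofReal_le_one.2 ht
    _ = _ := by rw [one_mul, mul_pow]

theorem IsRegularMatrix.eLpNorm_two_bilinForm_le_left (h : IsRegularMatrix μ α X) {τ : ℝ}
    {s t : Fin n → ℝ} (hs : ∀ i, |s i| ≤ τ) (ht : ∑ j, t j ^ 2 ≤ 1) :
    eLpNorm (bilinForm X s t) 2 μ ≤ ENNReal.ofReal τ * (ENNReal.ofReal α * expOpNorm μ X) := by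
  refine (ENNReal.pow_le_pow_left_iff two_ne_zero).1 ?_
  rw [h.eLpNorm_two_bilinForm_sq, Fintype.sum_prod_type_right]
  exact sum_weighted_le (v := fun i j => ∫⁻ ω, ENNReal.ofReal (X i j ω ^ 2) ∂μ)
    (col_second_moment_le h.integrable h.regular) hs ht

theorem IsRegularMatrix.eLpNorm_two_bilinForm_le_right (h : IsRegularMatrix μ α X) {τ : ℝ}
    {s t : Fin n → ℝ} (hs : ∑ i, s i ^ 2 ≤ 1) (ht : ∀ j, |t j| ≤ τ) :
    eLpNorm (bilinForm X s t) 2 μ ≤ ENNReal.ofReal τ * (ENNReal.ofReal α * expOpNorm μ X) := by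
  refine (ENNReal.pow_le_pow_left_iff two_ne_zero).1 ?_
  rw [h.eLpNorm_two_bilinForm_sq, Fintype.sum_prod_type]
  simp_rw [fun i j => mul_comm (s i) (t j)]
  exact sum_weighted_le (v := fun j i => ∫⁻ ω, ENNReal.ofReal (X i j ω ^ 2) ∂μ)
    (row_second_moment_le h.integrable h.regular) ht hs

end BilinearForm

/-! ### A lower tail bound from moment growth. -/

section PaleyZygmund

variable {Ω : Type*} [MeasurableSpace Ω] {μ : Measure Ω}

/-- A Paley–Zygmund type inequality. -/
theorem one_le_mul_measure_le_enorm [IsProbabilityMeasure μ] {S : Ω → ℝ} (hS : Measurable S)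
    {P : ℕ} (hP : 1 ≤ P) {u A : ℝ≥0∞} (hfin : eLpNorm S P μ ≠ ⊤) (hu : 2 * u < eLpNorm S P μ)
    (hA : eLpNorm S (2 * P : ℕ) μ ≤ A * eLpNorm S P μ) :
    1 ≤ 4 * A ^ (2 * P) * μ {ω | u ≤ ‖S ω‖ₑ} := by
  set B := {ω | u ≤ ‖S ω‖ₑ} with hB
  have hBm : MeasurableSet B := measurableSet_le measurable_const hS.enorm
  set E := eLpNorm S P μ ^ P with hE
  have hE0 : E ≠ 0 := pow_ne_zero _ (ne_bot_of_gt hu)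
  have hEt : E ≠ ⊤ := ENNReal.pow_ne_top hfin
  -- Because `2 ≤ 2 ^ P`, the part of the moment below level `u` is at most half; Cauchy–Schwarz
  -- handles the part on `B`.
  have hu2 : u ^ P ≤ E / 2 := by
    rw [ENNReal.le_div_iff_mul_le (by simp) (by simp)]
    calc u ^ P * 2 ≤ u ^ P * 2 ^ P := by
          gcongr
          exact le_self_pow₀ (by norm_num) (by omega)
      _ = (2 * u) ^ P := by rw [mul_pow, mul_comm]
      _ ≤ E := pow_le_pow_left' hu.le P
  have hle : E ≤ E / 2 + A ^ P * E * μ B ^ (1 / 2 : ℝ) := by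
    calc E = ∫⁻ ω, ‖S ω‖ₑ ^ P ∂μ := eLpNorm_natCast_pow hP
      _ ≤ ∫⁻ ω, (u ^ P + ‖S ω‖ₑ ^ P * B.indicator 1 ω) ∂μ := by
          refine lintegral_mono fun ω => ?_
          by_cases h : ω ∈ B
          · simp [h]
          · have : ‖S ω‖ₑ ≤ u := le_of_lt (not_le.1 h)
            simp only [h, not_false_eq_true, Set.indicator_of_notMem, mul_zero, add_zero]
            exact pow_le_pow_left' this P
      _ = u ^ P + ∫⁻ ω, ‖S ω‖ₑ ^ P * B.indicator 1 ω ∂μ := by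
          rw [lintegral_add_left measurable_const]
          simp
      _ ≤ E / 2 + (∫⁻ ω, (‖S ω‖ₑ ^ P) ^ (2 : ℝ) ∂μ) ^ (1 / 2 : ℝ) *
            (∫⁻ ω, (B.indicator 1 ω : ℝ≥0∞) ^ (2 : ℝ) ∂μ) ^ (1 / 2 : ℝ) :=
          add_le_add hu2 (ENNReal.lintegral_mul_le_Lp_mul_Lq μ Real.HolderConjugate.two_two
            (hS.enorm.pow_const P).aemeasurable (measurable_one.indicator hBm).aemeasurable)
      _ ≤ E / 2 + A ^ P * E * μ B ^ (1 / 2 : ℝ) := by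
          have h1 : ∫⁻ ω, (B.indicator 1 ω : ℝ≥0∞) ^ (2 : ℝ) ∂μ = μ B := by
            rw [← lintegral_indicator_one hBm]
            refine lintegral_congr fun ω => ?_
            by_cases h : ω ∈ B <;> simp [h]
          have h2 : (∫⁻ ω, (‖S ω‖ₑ ^ P) ^ (2 : ℝ) ∂μ) ^ (1 / 2 : ℝ) ≤ A ^ P * E := by
            have h3 : ∫⁻ ω, (‖S ω‖ₑ ^ P) ^ (2 : ℝ) ∂μ = eLpNorm S (2 * P : ℕ) μ ^ (2 * P) := by
              rw [eLpNorm_natCast_pow (by omega)]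
              refine lintegral_congr fun ω => ?_
              rw [ENNReal.rpow_ofNat, ← pow_mul, mul_comm]
            rw [h3, mul_comm 2 P, pow_mul, ← ENNReal.rpow_natCast (_ ^ P), ← ENNReal.rpow_mul]
            simp only [Nat.cast_ofNat, one_div, ne_eq, OfNat.ofNat_ne_zero, not_false_eq_true,
              mul_inv_cancel₀, ENNReal.rpow_one]
            rw [hE, ← mul_pow, mul_comm P 2]
            exact pow_le_pow_left' hA P
          rw [h1]
          gcongr
  have hhalf : E / 2 ≤ A ^ P * E * μ B ^ (1 / 2 : ℝ) := by
    nth_rewrite 1 [← ENNReal.add_halves E] at hle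
    exact (ENNReal.add_le_add_iff_left (ENNReal.div_ne_top hEt (by simp))).1 hle
  have h1 : 1 ≤ 2 * (A ^ P * μ B ^ (1 / 2 : ℝ)) := by
    rw [ENNReal.div_le_iff_le_mul (by simp) (by simp)] at hhalf
    refine (ENNReal.mul_le_mul_iff_right hE0 hEt).1 ?_
    calc E * 1 = E := mul_one E
      _ ≤ _ := hhalf
      _ = _ := by ring
  calc (1 : ℝ≥0∞) = 1 ^ 2 := by simp
    _ ≤ (2 * (A ^ P * μ B ^ (1 / 2 : ℝ))) ^ 2 := pow_le_pow_left' h1 2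
    _ = 4 * A ^ (2 * P) * (μ B ^ (1 / 2 : ℝ)) ^ 2 := by ring
    _ = _ := by
      rw [← ENNReal.rpow_natCast (μ B ^ (1 / 2 : ℝ)), ← ENNReal.rpow_mul]
      simp

end PaleyZygmund

/-! ### Disjoint supports and independent forms. -/

section Blocks

/-- Greedy selection: the union of the supports chosen so far has at most `N * b ≤ k` elements, so
it is an admissible `I`. -/
theorem exists_disjoint_blocks {V D : Type*} [DecidableEq V] (supp : D → Finset V)
    (Q : D → Prop) {k b : ℕ} (h : ∀ I : Finset V, I.card ≤ k →
      ∃ x, Q x ∧ Disjoint I (supp x) ∧ (supp x).card ≤ b) (N : ℕ) (hN : N * b ≤ k) :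
    ∃ x : ℕ → D, (∀ l < N, Q (x l) ∧ (supp (x l)).card ≤ b) ∧
      ∀ l' < N, ∀ l < l', Disjoint (supp (x l)) (supp (x l')) := by
  induction N with
  | zero =>
    obtain ⟨x, -⟩ := h ∅ (by simp)
    exact ⟨fun _ => x, by simp, by simp⟩
  | succ N ih =>
    obtain ⟨x, hx, hd⟩ := ih (le_trans (Nat.mul_le_mul_right _ N.le_succ) hN)
    obtain ⟨y, hy, hyd, hyc⟩ := h ((Finset.range N).biUnion fun l => supp (x l)) (by
      refine (Finset.card_biUnion_le_card_mul _ _ b fun l hl =>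
        (hx l (Finset.mem_range.1 hl)).2).trans ?_
      rw [Finset.card_range]
      exact le_trans (Nat.mul_le_mul_right _ N.le_succ) hN)
    refine ⟨Function.update x N y, fun l hl => ?_, fun l' hl' l hl => ?_⟩
    · rcases Nat.lt_succ_iff_lt_or_eq.1 hl with h1 | rfl
      · rw [Function.update_of_ne h1.ne]
        exact hx l h1
      · rw [Function.update_self]
        exact ⟨hy, hyc⟩
    · rcases Nat.lt_succ_iff_lt_or_eq.1 hl' with h1 | rfl
      · rw [Function.update_of_ne h1.ne, Function.update_of_ne (hl.trans h1).ne]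
        exact hd l' h1 l hl
      · rw [Function.update_self, Function.update_of_ne hl.ne]
        exact (Finset.disjoint_biUnion_left _ _ _).1 hyd l (Finset.mem_range.2 hl)

variable {n : ℕ} {Ω : Type*}

theorem bilinForm_eq_sum_of_support (X : Fin n → Fin n → Ω → ℝ) {s t : Fin n → ℝ}
    {J : Finset (Fin n)} (hs : ∀ i ∉ J, s i = 0) (ht : ∀ i ∉ J, t i = 0)
    {T : Finset (Fin n × Fin n)} (hT : J ×ˢ J ⊆ T) (ω : Ω) :
    bilinForm X s t ω = ∑ q : T, s q.1.1 * t q.1.2 * X q.1.1 q.1.2 ω := by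
  rw [Finset.sum_coe_sort T fun q => s q.1 * t q.2 * X q.1 q.2 ω]
  refine (Finset.sum_subset (Finset.subset_univ _) fun q _ hq => ?_).symm
  have hq' := mt (@hT q) hq
  rw [Finset.mem_product, not_and_or] at hq'
  rcases hq' with hq' | hq'
  · rw [hs _ hq']; ring
  · rw [ht _ hq']; ring

variable [MeasurableSpace Ω] {μ : Measure Ω} [IsProbabilityMeasure μ]
  {X : Fin n → Fin n → Ω → ℝ} {α : ℝ}

theorem IsRegularMatrix.measure_iInter_bilinForm_lt (h : IsRegularMatrix μ α X) {κ : Type*}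
    {J : κ → Finset (Fin n)} (hJ : Pairwise fun l l' => Disjoint (J l) (J l'))
    {s t : κ → Fin n → ℝ} (hs : ∀ l, ∀ i ∉ J l, s l i = 0) (ht : ∀ l, ∀ i ∉ J l, t l i = 0)
    (u : ℝ≥0∞) (Λ : Finset κ) :
    μ (⋂ l ∈ Λ, {ω | ‖bilinForm X (s l) (t l) ω‖ₑ < u}) =
      ∏ l ∈ Λ, μ {ω | ‖bilinForm X (s l) (t l) ω‖ₑ < u} := by
  classical
  induction Λ using Finset.induction_on with
  | empty => simp
  | insert l Λ hl ih =>
    rw [Finset.prod_insert hl, ← ih, Finset.set_biInter_insert]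
    set T := Λ.biUnion fun l => J l ×ˢ J l with hT
    have hdisj : Disjoint (J l ×ˢ J l) T := by
      refine (Finset.disjoint_biUnion_right _ _ _).2 fun l' hl' => ?_
      exact Finset.disjoint_product.2 (Or.inl (hJ fun e => hl (e ▸ hl')))
    have hind := h.indep.indepFun_finset _ _ hdisj fun q => h.measurable q.1 q.2
    have h1 : MeasurableSet {x : (J l ×ˢ J l : Finset (Fin n × Fin n)) → ℝ |
        ‖∑ q, s l q.1.1 * t l q.1.2 * x q‖ₑ < u} :=
      measurableSet_lt (by fun_prop) measurable_const
    have h2 : MeasurableSet (⋂ l' ∈ Λ, {x : T → ℝ |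
        ‖∑ q, s l' q.1.1 * t l' q.1.2 * x q‖ₑ < u}) :=
      Finset.measurableSet_biInter _ fun l' _ => measurableSet_lt (by fun_prop) measurable_const
    have h3 := hind.measure_inter_preimage_eq_mul _ _ h1 h2
    have e1 : {ω | ‖bilinForm X (s l) (t l) ω‖ₑ < u} =
        (fun ω (q : (J l ×ˢ J l : Finset (Fin n × Fin n))) => X q.1.1 q.1.2 ω) ⁻¹' {x |
          ‖∑ q, s l q.1.1 * t l q.1.2 * x q‖ₑ < u} := by
      ext ω
      simp only [Set.mem_ofPred_eq, Set.mem_preimage]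
      rw [bilinForm_eq_sum_of_support X (hs l) (ht l) subset_rfl]
    have e2 : ⋂ l' ∈ Λ, {ω | ‖bilinForm X (s l') (t l') ω‖ₑ < u} =
        (fun ω (q : T) => X q.1.1 q.1.2 ω) ⁻¹' (⋂ l' ∈ Λ, {x : T → ℝ |
          ‖∑ q, s l' q.1.1 * t l' q.1.2 * x q‖ₑ < u}) := by
      ext ω
      simp only [Set.mem_iInter, Set.mem_ofPred_eq, Set.mem_preimage]
      refine forall₂_congr fun l' hl' => ?_
      rw [bilinForm_eq_sum_of_support X (hs l') (ht l')
        (Finset.subset_biUnion_of_mem (fun l => J l ×ˢ J l) hl')]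
    rw [e1, e2]
    exact h3

/-- By independence all forms stay below `u` with probability at most `(1 - 1/N)^N ≤ e⁻¹ ≤ 1/2`;
otherwise one of them bounds the operator norm below by `u`. -/
theorem IsRegularMatrix.half_le_expOpNorm (h : IsRegularMatrix μ α X) {N : ℕ} (hN : 1 ≤ N)
    {J : Fin N → Finset (Fin n)} (hJ : Pairwise fun l l' => Disjoint (J l) (J l'))
    {s t : Fin N → Fin n → ℝ} (hs : ∀ l, ∀ i ∉ J l, s l i = 0) (ht : ∀ l, ∀ i ∉ J l, t l i = 0)
    (hs1 : ∀ l, ∑ i, s l i ^ 2 ≤ 1) (ht1 : ∀ l, ∑ i, t l i ^ 2 ≤ 1) {u : ℝ≥0∞}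
    (hu : ∀ l, (N : ℝ≥0∞)⁻¹ ≤ μ {ω | u ≤ ‖bilinForm X (s l) (t l) ω‖ₑ}) :
    u / 2 ≤ expOpNorm μ X := by
  have hm : ∀ l, Measurable (bilinForm X (s l) (t l)) := fun l => measurable_bilinForm h.measurable _ _
  set B : Fin N → Set Ω := fun l => {ω | ‖bilinForm X (s l) (t l) ω‖ₑ < u} with hB
  have hBm : ∀ l, MeasurableSet (B l) := fun l => measurableSet_lt (hm l).enorm measurable_const
  have hBle : ∀ l, μ.real (B l) ≤ 1 - (N : ℝ)⁻¹ := by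
    intro l
    have h1 : (B l)ᶜ = {ω | u ≤ ‖bilinForm X (s l) (t l) ω‖ₑ} := by
      ext ω; simp [hB]
    have h2 := hu l
    rw [← h1] at h2
    have h3 := ENNReal.toReal_mono (measure_ne_top μ _) h2
    rw [ENNReal.toReal_inv, ENNReal.toReal_natCast] at h3
    have h4 := probReal_compl_eq_one_sub (μ := μ) (hBm l)
    simp only [measureReal_def] at h4 ⊢
    linarith
  have hinter : μ.real (⋂ l, B l) ≤ 1 / 2 := by
    have h1 := h.measure_iInter_bilinForm_lt hJ hs ht u Finset.univ
    have h2 : μ.real (⋂ l, B l) = ∏ l, μ.real (B l) := by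
      simp only [Finset.mem_univ, Set.iInter_true] at h1
      simp only [measureReal_def, ← ENNReal.toReal_prod]
      exact congrArg ENNReal.toReal h1
    have hN0 : (N : ℝ) ≠ 0 := by exact_mod_cast (by omega : N ≠ 0)
    calc μ.real (⋂ l, B l) = ∏ l, μ.real (B l) := h2
      _ ≤ ∏ _l : Fin N, Real.exp (-(N : ℝ)⁻¹) :=
          Finset.prod_le_prod (fun l _ => measureReal_nonneg) fun l _ =>
            (hBle l).trans (Real.one_sub_le_exp_neg _)
      _ = Real.exp (-1) := by
          rw [Finset.prod_const, Finset.card_univ, Fintype.card_fin, ← Real.exp_nat_mul]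
          congr 1
          field_simp
      _ ≤ 1 / 2 := by
          rw [Real.exp_neg, one_div]
          refine inv_anti₀ (by norm_num) ?_
          have := Real.add_one_le_exp (1 : ℝ)
          linarith
  have hIm : MeasurableSet (⋂ l, B l) := MeasurableSet.iInter hBm
  have hcompl : (1 / 2 : ℝ≥0∞) ≤ μ (⋂ l, B l)ᶜ := by
    have h4 := probReal_compl_eq_one_sub (μ := μ) hIm
    have h5 : (1 / 2 : ℝ) ≤ μ.real (⋂ l, B l)ᶜ := by linarith
    rw [measureReal_def] at h5
    have := ENNReal.ofReal_le_of_le_toReal h5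
    rwa [ENNReal.ofReal_div_of_pos (by norm_num), ENNReal.ofReal_one, ENNReal.ofReal_ofNat] at this
  calc u / 2 = u * (1 / 2) := by rw [div_eq_mul_one_div]
    _ ≤ u * μ (⋂ l, B l)ᶜ := mul_le_mul_right hcompl u
    _ = ∫⁻ ω, (⋂ l, B l)ᶜ.indicator (fun _ => u) ω ∂μ := by
        rw [lintegral_indicator_const hIm.compl]
    _ ≤ expOpNorm μ X := by
        refine lintegral_mono fun ω => ?_
        by_cases hω : ω ∈ (⋂ l, B l)ᶜ
        · rw [Set.indicator_of_mem hω]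
          simp only [Set.mem_compl_iff, Set.mem_iInter, not_forall] at hω
          obtain ⟨l, hl⟩ := hω
          have h1 : u ≤ ‖bilinForm X (s l) (t l) ω‖ₑ := not_lt.1 hl
          refine h1.trans ((enorm_bilinForm_le X (s l) (t l) ω).trans ?_)
          refine (mul_le_mul_left (ENNReal.ofReal_le_one.2 ?_) _).trans (one_mul _).le
          exact mul_le_one₀ (Real.sqrt_le_one.2 (hs1 l)) (Real.sqrt_nonneg _)
            (Real.sqrt_le_one.2 (ht1 l))
        · rw [Set.indicator_of_notMem hω]
          exact zero_le

end Blocks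

/-! ### Choice of scales. -/

/-- Here `p` is the Paley–Zygmund scale, `N` the number of blocks, `b` the support bound and `τ` the
truncation level. The exponents `2 ^ p` and `2 ^ (p + (a + 5)) ≥ L` differ by a factor depending
only on `a`, so passing between them costs the constant `A ^ (a + 5)`. -/
theorem exists_scales {a : ℕ} {A : ℝ} (hA1 : 1 ≤ A) (hA : A ≤ 2 ^ a) {k : ℕ}
    (hk : 2 ^ (a + 6) ≤ Real.log ((k : ℝ) + 1)) :
    ∃ (p N b : ℕ) (τ : ℝ), 1 ≤ p ∧ 1 ≤ N ∧ 0 < τ ∧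
      Real.log ((k : ℝ) + 1) ≤ 2 ^ (p + (a + 5)) ∧
      A ^ (p + (a + 5)) * τ ≤ 16 ^ a * (a.factorial : ℝ) ∧
      (∀ c : ℕ, c * τ ^ 2 ≤ 2 → c ≤ b) ∧ N * b ≤ k ∧ 4 * A ^ (2 * 2 ^ p) ≤ N := by
  set L := Real.log ((k : ℝ) + 1) with hL
  have h2a : (1 : ℝ) ≤ 2 ^ a := one_le_pow₀ (by norm_num)
  have haa : (a : ℝ) ≤ 2 ^ a := by exact_mod_cast Nat.lt_two_pow_self.le
  have h64 : 64 ≤ L := by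
    refine le_trans ?_ hk
    rw [pow_add]
    linarith
  obtain ⟨m', hm1, hm2⟩ := exists_nat_pow_near (by linarith : 1 ≤ L) (one_lt_two (α := ℝ))
  have hm : a + 6 < m' + 1 := (pow_lt_pow_iff_right₀ (one_lt_two (α := ℝ))).1 (hk.trans_lt hm2)
  obtain ⟨p, hp⟩ : ∃ p, m' + 1 = p + (a + 5) := ⟨m' - (a + 4), by omega⟩
  have h2L : (2 : ℝ) ^ (p + (a + 5)) ≤ 2 * L := by
    rw [← hp, pow_succ]; linarith
  have hexp : Real.exp L = k + 1 := Real.exp_log (by positivity)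
  -- The choice balances three demands: `τ² = e^{-L/4}` gives supports of size `2 e^{L/4}`; `N * b ≤
  -- 4 e^{L/2}` stays below `k = e^L - 1`; and `2 ^ p ≤ L / (16 * 2 ^ a)` keeps `4 A^{2·2^p}` below
  -- `e^{L/4}`.
  refine ⟨p, ⌈Real.exp (L / 4)⌉₊, ⌊2 * Real.exp (L / 4)⌋₊, Real.exp (-(L / 8)), by omega,
    Nat.one_le_ceil_iff.2 (Real.exp_pos _), Real.exp_pos _, ?_, ?_, ?_, ?_, ?_⟩
  · rw [← hp]; exact hm2.le
  · rw [Real.exp_neg, ← div_eq_mul_inv, div_le_iff₀ (Real.exp_pos _)]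
    have h1 := Real.pow_div_factorial_le_exp (x := L / 8) (by linarith) a
    rw [div_le_iff₀ (by positivity)] at h1
    calc A ^ (p + (a + 5)) ≤ (2 ^ a) ^ (p + (a + 5)) := pow_le_pow_left₀ (by linarith) hA _
      _ = (2 ^ (p + (a + 5))) ^ a := by rw [← pow_mul, ← pow_mul, mul_comm]
      _ ≤ (2 * L) ^ a := pow_le_pow_left₀ (by positivity) h2L _
      _ = 16 ^ a * (L / 8) ^ a := by rw [← mul_pow]; ring
      _ ≤ 16 ^ a * (Real.exp (L / 8) * a.factorial) := by gcongr
      _ = _ := by ring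
  · intro c hc
    refine Nat.le_floor ?_
    rw [← Real.exp_nat_mul, show ((2 : ℕ) : ℝ) * -(L / 8) = -(L / 4) by push_cast; ring,
      Real.exp_neg, ← div_eq_mul_inv, div_le_iff₀ (Real.exp_pos _)] at hc
    exact hc
  · have hy : 1 ≤ Real.exp (L / 4) := Real.one_le_exp (by linarith)
    have h1 : (⌈Real.exp (L / 4)⌉₊ : ℝ) ≤ 2 * Real.exp (L / 4) := by
      have := Nat.ceil_lt_add_one (Real.exp_pos (L / 4)).le
      linarith
    have h2 : (⌊2 * Real.exp (L / 4)⌋₊ : ℝ) ≤ 2 * Real.exp (L / 4) :=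
      Nat.floor_le (by positivity)
    have h3 : Real.exp (L / 4) * Real.exp (L / 4) = Real.exp (L / 2) := by
      rw [← Real.exp_add]; ring_nf
    have h4 : Real.exp (L / 2) * Real.exp (L / 2) = k + 1 := by
      rw [← Real.exp_add, ← hexp]; ring_nf
    have h5 := Real.add_one_le_exp (L / 2)
    have h6 : ((⌈Real.exp (L / 4)⌉₊ * ⌊2 * Real.exp (L / 4)⌋₊ : ℕ) : ℝ) ≤ k := by
      push_cast
      calc (⌈Real.exp (L / 4)⌉₊ : ℝ) * ⌊2 * Real.exp (L / 4)⌋₊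
          ≤ 2 * Real.exp (L / 4) * (2 * Real.exp (L / 4)) := by gcongr
        _ = 4 * Real.exp (L / 2) := by rw [← h3]; ring
        _ ≤ k := by nlinarith
    exact_mod_cast h6
  · refine le_trans ?_ (Nat.le_ceil _)
    have he : (2 : ℝ) ≤ Real.exp 1 := by
      have := Real.add_one_le_exp (1 : ℝ)
      linarith
    have h4 : (4 : ℝ) ≤ Real.exp (L / 8) := by
      have := Real.add_one_le_exp (L / 8)
      linarith
    have h5 : (a * (2 * 2 ^ p) : ℝ) ≤ L / 8 := by
      have e : (2 : ℝ) ^ (p + (a + 5)) = 2 ^ p * 2 ^ a * 32 := by ring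
      rw [e] at h2L
      have : (a : ℝ) * 2 ^ p ≤ 2 ^ a * 2 ^ p := by gcongr
      linarith
    calc 4 * A ^ (2 * 2 ^ p) ≤ Real.exp (L / 8) * (2 ^ a) ^ (2 * 2 ^ p) := by gcongr
      _ ≤ Real.exp (L / 8) * (Real.exp 1 ^ a) ^ (2 * 2 ^ p) := by gcongr
      _ = Real.exp (L / 8) * Real.exp (a * (2 * 2 ^ p)) := by
          rw [← pow_mul, ← Real.exp_nat_mul]
          push_cast
          ring_nf
      _ ≤ Real.exp (L / 8) * Real.exp (L / 8) := by gcongr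
      _ = Real.exp (L / 4) := by rw [← Real.exp_add]; ring_nf

/-! ### Removing the small coordinates. -/

section Truncation

variable {n : ℕ}

/-- The coordinates of absolute value at most `τ` are replaced by `0`. -/
noncomputable def truncate (τ : ℝ) (s : Fin n → ℝ) (i : Fin n) : ℝ :=
  if τ < |s i| then s i else 0

theorem abs_sub_truncate_le {τ : ℝ} (hτ : 0 ≤ τ) (s : Fin n → ℝ) (i : Fin n) :
    |(s - truncate τ s) i| ≤ τ := by
  simp only [Pi.sub_apply, truncate]
  split_ifs with h
  · simpa using hτ
  · simpa using not_lt.1 h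

theorem sum_truncate_sq_le (τ : ℝ) {s : Fin n → ℝ} (hs : ∑ i, s i ^ 2 ≤ 1) :
    ∑ i, truncate τ s i ^ 2 ≤ 1 := by
  refine (Finset.sum_le_sum fun i _ => ?_).trans hs
  unfold truncate
  split_ifs
  · exact le_rfl
  · simpa using sq_nonneg (s i)

theorem card_filter_lt_abs_mul_sq_le {τ : ℝ} (hτ : 0 ≤ τ) {s : Fin n → ℝ}
    (hs : ∑ i, s i ^ 2 ≤ 1) :
    ((Finset.univ.filter fun i => τ < |s i|).card : ℝ) * τ ^ 2 ≤ 1 := by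
  refine le_trans ?_ hs
  rw [← nsmul_eq_mul, ← Finset.sum_const]
  refine (Finset.sum_le_sum fun i hi => ?_).trans
    (Finset.sum_le_sum_of_subset_of_nonneg (Finset.filter_subset _ _) fun i _ _ => sq_nonneg _)
  rw [← sq_abs (s i)]
  exact pow_le_pow_left₀ hτ (Finset.mem_filter.1 hi).2.le 2

variable {Ω : Type*} [MeasurableSpace Ω] {μ : Measure Ω} [IsProbabilityMeasure μ]
  {X : Fin n → Fin n → Ω → ℝ} {α : ℝ}

theorem IsRegularMatrix.eLpNorm_bilinForm_le_truncate (hα : 1 ≤ α) (h : IsRegularMatrix μ α X)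
    {τ D : ℝ} (hτ : 0 ≤ τ) {m : ℕ} (hm : 1 ≤ m) (hD : (8 * α) ^ m * τ ≤ D) {s t : Fin n → ℝ}
    (hs : ∑ i, s i ^ 2 ≤ 1) (ht : ∑ i, t i ^ 2 ≤ 1) :
    eLpNorm (bilinForm X s t) (2 ^ m : ℕ) μ ≤
      eLpNorm (bilinForm X (truncate τ s) (truncate τ t)) (2 ^ m : ℕ) μ +
        2 * (ENNReal.ofReal D * (ENNReal.ofReal α * expOpNorm μ X)) := by
  have hone : (1 : ℝ≥0∞) ≤ (2 ^ m : ℕ) := by exact_mod_cast Nat.one_le_two_pow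
  have hsm : ∀ u v : Fin n → ℝ, AEStronglyMeasurable (bilinForm X u v) μ := fun u v =>
    (measurable_bilinForm h.measurable u v).aestronglyMeasurable
  have hsmall : ∀ u v : Fin n → ℝ, eLpNorm (bilinForm X u v) 2 μ ≤
      ENNReal.ofReal τ * (ENNReal.ofReal α * expOpNorm μ X) →
      eLpNorm (bilinForm X u v) (2 ^ m : ℕ) μ ≤
        ENNReal.ofReal D * (ENNReal.ofReal α * expOpNorm μ X) := by
    intro u v huv
    obtain ⟨d, rfl⟩ := Nat.exists_eq_add_of_le hm
    refine (h.eLpNorm_two_pow_bilinForm_le hα u v le_rfl d).trans ?_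
    simp only [pow_one, Nat.cast_ofNat]
    refine (mul_le_mul_right huv _).trans ?_
    rw [← mul_assoc, ← ENNReal.ofReal_pow (by positivity), ← ENNReal.ofReal_mul (by positivity)]
    refine mul_le_mul_left (ENNReal.ofReal_le_ofReal (le_trans ?_ hD)) _
    gcongr
    · linarith
    · omega
  -- In each of the last two terms one vector is bounded by `τ` coordinatewise, so its second moment
  -- is small.
  have e : bilinForm X s t = bilinForm X (truncate τ s) (truncate τ t) +
      (bilinForm X (truncate τ s) (t - truncate τ t) + bilinForm X (s - truncate τ s) t) := by
    rw [← add_assoc, ← bilinForm_add_right, add_sub_cancel, ← bilinForm_add_left,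
      add_sub_cancel]
  rw [e, two_mul]
  refine (eLpNorm_add_le (hsm _ _) ((hsm _ _).add (hsm _ _)) hone).trans (add_le_add le_rfl ?_)
  refine (eLpNorm_add_le (hsm _ _) (hsm _ _) hone).trans (add_le_add ?_ ?_)
  · exact hsmall _ _ (h.eLpNorm_two_bilinForm_le_right (sum_truncate_sq_le τ hs)
      (abs_sub_truncate_le hτ t))
  · exact hsmall _ _ (h.eLpNorm_two_bilinForm_le_left (abs_sub_truncate_le hτ s) ht)

end Truncation

/-! ### The bound on the third summand. -/

section WeakNorm

variable {n : ℕ} {Ω : Type*} [MeasurableSpace Ω] {μ : Measure Ω}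

theorem weakNormOutside_le {X : Fin n → Fin n → Ω → ℝ} {I : Finset (Fin n)} {p : ℝ} {b : ℝ≥0∞}
    (h : ∀ s t : Fin n → ℝ, ∑ i, s i ^ 2 ≤ 1 → ∑ i, t i ^ 2 ≤ 1 → (∀ i ∈ I, s i = 0) →
      (∀ i ∈ I, t i = 0) → eLpNorm (bilinForm X s t) (ENNReal.ofReal p) μ ≤ b) :
    weakNormOutside μ X I p ≤ b := by
  refine iSup_le fun s => iSup_le fun t => iSup_le fun hs => iSup_le fun ht => ?_
  have hrestrict : ∀ u : EuclideanSpace ℝ (Fin n), ‖u‖ ≤ 1 →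
      ∑ i, (if i ∈ I then 0 else u i) ^ 2 ≤ 1 := by
    intro u hu
    rw [EuclideanSpace.norm_eq, Real.sqrt_le_one] at hu
    refine (Finset.sum_le_sum fun i _ => ?_).trans hu
    split_ifs
    · simpa using sq_nonneg (u i)
    · simp
  have h1 := h (fun i => if i ∈ I then 0 else s i) (fun i => if i ∈ I then 0 else t i)
    (hrestrict s hs) (hrestrict t ht) (fun i hi => if_pos hi) fun i hi => if_pos hi
  unfold lpNormRV
  refine (congrArg (fun f => eLpNorm f (ENNReal.ofReal p) μ) ?_).trans_le h1
  ext ω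
  unfold bilinForm
  rw [Fintype.sum_prod_type]
  have hI : ∀ f : Fin n → ℝ, ∑ i ∈ Iᶜ, f i = ∑ i, if i ∈ I then 0 else f i := by
    intro f
    rw [← Finset.sum_subset (Finset.subset_univ Iᶜ) (fun i _ hi => by
      rw [if_pos (by simpa using hi)])]
    exact Finset.sum_congr rfl fun i hi => (if_neg (Finset.mem_compl.1 hi)).symm
  rw [hI]
  refine Finset.sum_congr rfl fun i _ => ?_
  by_cases hi : i ∈ I
  · simp [hi]
  · simp only [hi, if_false]
    rw [hI]
    refine Finset.sum_congr rfl fun j _ => ?_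
    by_cases hj : j ∈ I
    · simp [hj]
    · simp only [hj, if_false]
      ring

variable [IsProbabilityMeasure μ] {X : Fin n → Fin n → Ω → ℝ} {α : ℝ}

/-- The exponent `log (k + 1)` can be below 1, where the triangle inequality fails; moving up to a
power of two avoids this. -/
theorem IsRegularMatrix.eLpNorm_bilinForm_le_two_pow (h : IsRegularMatrix μ α X) (s t : Fin n → ℝ)
    {L : ℝ} {m : ℕ} (hL : L ≤ 2 ^ m) :
    eLpNorm (bilinForm X s t) (ENNReal.ofReal L) μ ≤ eLpNorm (bilinForm X s t) (2 ^ m : ℕ) μ := by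
  refine eLpNorm_le_eLpNorm_of_exponent_le ?_
    (measurable_bilinForm h.measurable s t).aestronglyMeasurable
  rw [← ENNReal.ofReal_natCast]
  exact ENNReal.ofReal_le_ofReal (by exact_mod_cast hL)

theorem abs_le_one_of_sum_sq_le_one {s : Fin n → ℝ} (hs : ∑ i, s i ^ 2 ≤ 1) (i : Fin n) :
    |s i| ≤ 1 := by
  rw [← sq_le_one_iff_abs_le_one]
  exact (Finset.single_le_sum (f := fun i => s i ^ 2) (fun i _ => sq_nonneg _)
    (Finset.mem_univ i)).trans hs

theorem IsRegularMatrix.eLpNorm_two_pow_bilinForm_le_expOpNorm (hα : 1 ≤ α)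
    (h : IsRegularMatrix μ α X) {s t : Fin n → ℝ}
    (hs : ∑ i, s i ^ 2 ≤ 1) (ht : ∑ i, t i ^ 2 ≤ 1) (d : ℕ) :
    eLpNorm (bilinForm X s t) (2 ^ (1 + d) : ℕ) μ ≤
      ENNReal.ofReal (8 * α) ^ d * (ENNReal.ofReal α * expOpNorm μ X) := by
  refine (h.eLpNorm_two_pow_bilinForm_le hα s t le_rfl d).trans (mul_le_mul_right ?_ _)
  have := h.eLpNorm_two_bilinForm_le_left (abs_le_one_of_sum_sq_le_one hs) ht
  simpa using this

/-- The constant in the bound of the third summand, with `8 * α ≤ 2 ^ a`. -/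
noncomputable def weakConst (α : ℝ) (a : ℕ) : ℝ≥0∞ :=
  ENNReal.ofReal (8 * α) ^ (a + 5) * ENNReal.ofReal α + (ENNReal.ofReal (8 * α) ^ (a + 5) * 6 +
    2 * (ENNReal.ofReal (16 ^ a * a.factorial) * ENNReal.ofReal α))

theorem weakConst_ne_top (α : ℝ) (a : ℕ) : weakConst α a ≠ ⊤ := by
  unfold weakConst
  finiteness

theorem IsRegularMatrix.exists_weakNormOutside_le (hα : 1 ≤ α) (h : IsRegularMatrix μ α X) {a : ℕ}
    (ha : 8 * α ≤ 2 ^ a) (hM : expOpNorm μ X ≠ ⊤) (k : ℕ) :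
    ∃ I : Finset (Fin n), I.card ≤ k ∧
      weakNormOutside μ X I (Real.log ((k : ℝ) + 1)) ≤ weakConst α a * expOpNorm μ X := by
  set M := expOpNorm μ X with hMdef
  set A := ENNReal.ofReal (8 * α) with hA
  set L := Real.log ((k : ℝ) + 1) with hL
  rcases le_or_gt L (2 ^ (a + 6)) with hsmall | hlarge
  · refine ⟨∅, by simp, weakNormOutside_le fun s t hs ht _ _ => ?_⟩
    refine (h.eLpNorm_bilinForm_le_two_pow s t hsmall).trans ?_
    rw [show a + 6 = 1 + (a + 5) by ring]
    refine (h.eLpNorm_two_pow_bilinForm_le_expOpNorm hα hs ht (a + 5)).trans ?_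
    rw [← mul_assoc]
    exact mul_le_mul_left le_self_add _
  obtain ⟨p, N, b, τ, hp, hN, hτ, hLp, hD, hb, hNb, hAN⟩ :=
    exists_scales (by linarith : 1 ≤ 8 * α) ha hlarge.le
  -- The contradiction below cancels `M` from `3 * M ≤ 2 * M`, so `M = 0` is treated apart: every
  -- form then has zero norm.
  rcases eq_or_ne M 0 with hM0 | hM0
  · refine ⟨∅, by simp, weakNormOutside_le fun s t hs ht _ _ => ?_⟩
    refine (h.eLpNorm_bilinForm_le_two_pow s t hLp).trans ?_
    obtain ⟨d, hd⟩ : ∃ d, p + (a + 5) = 1 + d := ⟨p + (a + 5) - 1, by omega⟩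
    rw [hd]
    refine (h.eLpNorm_two_pow_bilinForm_le_expOpNorm hα hs ht d).trans ?_
    rw [← hMdef, hM0]
    simp
  by_contra! hcon
  -- If all forms supported on few coordinates outside `I` had moment norm at most `6 * M`,
  -- truncation would bound the weak norm outside `I`, contrary to `hcon`.
  have hbad : ∀ I : Finset (Fin n), I.card ≤ k → ∃ x : (Fin n → ℝ) × (Fin n → ℝ) × Finset (Fin n),
      ((∑ i, x.1 i ^ 2 ≤ 1 ∧ ∑ i, x.2.1 i ^ 2 ≤ 1) ∧ (∀ i ∉ x.2.2, x.1 i = 0) ∧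
        (∀ i ∉ x.2.2, x.2.1 i = 0) ∧ 6 * M < eLpNorm (bilinForm X x.1 x.2.1) (2 ^ p : ℕ) μ) ∧
      Disjoint I x.2.2 ∧ x.2.2.card ≤ b := by
    intro I hI
    have hI2 := hcon I hI
    contrapose! hI2
    refine weakNormOutside_le fun s t hs ht hsI htI => ?_
    refine (h.eLpNorm_bilinForm_le_two_pow s t hLp).trans ?_
    refine (h.eLpNorm_bilinForm_le_truncate hα hτ.le (by omega) hD hs ht).trans ?_
    have hle : eLpNorm (bilinForm X (truncate τ s) (truncate τ t)) (2 ^ p : ℕ) μ ≤ 6 * M := by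
      by_contra! hlt
      refine absurd (hI2 (truncate τ s, truncate τ t, (Finset.univ.filter fun i => τ < |s i|) ∪
        Finset.univ.filter fun i => τ < |t i|) ⟨⟨sum_truncate_sq_le τ hs, sum_truncate_sq_le τ ht⟩,
        fun i hi => ?_, fun i hi => ?_, hlt⟩ ?_) (not_lt.2 ?_)
      · simp only [Finset.mem_union, Finset.mem_filter, Finset.mem_univ, true_and, not_or] at hi
        exact if_neg hi.1
      · simp only [Finset.mem_union, Finset.mem_filter, Finset.mem_univ, true_and, not_or] at hi
        exact if_neg hi.2
      · rw [Finset.disjoint_left]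
        intro i hi
        simp [hsI i hi, htI i hi, hτ.le]
      · refine (Finset.card_union_le _ _).trans (hb _ ?_)
        push_cast
        have h1 := card_filter_lt_abs_mul_sq_le hτ.le hs
        have h2 := card_filter_lt_abs_mul_sq_le hτ.le ht
        linarith
    have h2 := (h.eLpNorm_two_pow_bilinForm_le hα (truncate τ s) (truncate τ t) hp (a + 5)).trans
      (mul_le_mul_right hle _)
    refine (add_le_add_left h2 _).trans ?_
    calc A ^ (a + 5) * (6 * M) + 2 * (ENNReal.ofReal (16 ^ a * a.factorial) *
          (ENNReal.ofReal α * M))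
        = (A ^ (a + 5) * 6 + 2 * (ENNReal.ofReal (16 ^ a * a.factorial) * ENNReal.ofReal α)) * M := by
          ring
      _ ≤ weakConst α a * M := mul_le_mul_left le_add_self _
  obtain ⟨x, hx, hxd⟩ := exists_disjoint_blocks (fun x : (Fin n → ℝ) × (Fin n → ℝ) ×
    Finset (Fin n) => x.2.2) _ hbad N hNb
  have hJ : Pairwise fun l l' : Fin N => Disjoint (x l).2.2 (x l').2.2 := by
    intro l l' hll
    rcases lt_or_gt_of_ne hll with h1 | h1
    · exact hxd l' l'.2 l h1
    · exact (hxd l l.2 l' h1).symm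
  have hfinal := h.half_le_expOpNorm hN (J := fun l => (x l).2.2) hJ
    (s := fun l => (x l).1) (t := fun l => (x l).2.1)
    (fun l => (hx l l.2).1.2.1) (fun l => (hx l l.2).1.2.2.1) (fun l => (hx l l.2).1.1.1)
    (fun l => (hx l l.2).1.1.2) (u := 3 * M) (fun l => ?_)
  · have h1 : 3 * M ≤ 2 * M := by
      rw [mul_comm 2]
      exact (ENNReal.div_le_iff_le_mul (by simp) (by simp)).1 hfinal
    have h2 := (ENNReal.mul_le_mul_iff_left hM0 hM).1 h1
    norm_num at h2
  · obtain ⟨-, -, -, hlt⟩ := (hx l l.2).1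
    have hreg := h.eLpNorm_two_pow_bilinForm_le hα (x l).1 (x l).2.1 hp 1
    have hfin : eLpNorm (bilinForm X (x l).1 (x l).2.1) (2 ^ p : ℕ) μ ≠ ⊤ := by
      obtain ⟨d, rfl⟩ := Nat.exists_eq_add_of_le hp
      refine ne_top_of_le_ne_top ?_
        (h.eLpNorm_two_pow_bilinForm_le_expOpNorm hα (hx l l.2).1.1.1 (hx l l.2).1.1.2 d)
      rw [← hMdef]
      finiteness
    rw [pow_succ' 2 p, pow_one] at hreg
    -- Level `3 * M` is half of `6 * M`, as Paley–Zygmund requires, yet more than twice `M`, as the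
    -- contradiction requires.
    have hpz := one_le_mul_measure_le_enorm
      (measurable_bilinForm h.measurable (x l).1 (x l).2.1) Nat.one_le_two_pow hfin
      (u := 3 * M) (by
        rw [← mul_assoc, show (2 : ℝ≥0∞) * 3 = 6 by norm_num]
        exact hlt) hreg
    have hN' : 4 * A ^ (2 * 2 ^ p) ≤ N := by
      have := ENNReal.ofReal_le_ofReal hAN
      rwa [ENNReal.ofReal_mul (by norm_num), ENNReal.ofReal_pow (by positivity),
        ENNReal.ofReal_ofNat, ENNReal.ofReal_natCast] at this
    rw [ENNReal.inv_le_iff_le_mul (by simp) (by simp)]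
    exact hpz.trans (mul_le_mul_left hN' _)

theorem IsRegularMatrix.maxMinWeak_le (hα : 1 ≤ α) (h : IsRegularMatrix μ α X) {a : ℕ}
    (ha : 8 * α ≤ 2 ^ a) (hM : expOpNorm μ X ≠ ⊤) :
    maxMinWeak μ X ≤ weakConst α a * expOpNorm μ X := by
  refine iSup₂_le fun k _ => ?_
  obtain ⟨I, hI, hle⟩ := h.exists_weakNormOutside_le hα ha hM k
  exact iInf₂_le_of_le I hI hle

end WeakNorm

/-! ### Assembly of the three bounds. -/

theorem mainTheorem7 (α : ℝ) (hα : 1 ≤ α) :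
    ∃ C : ℝ≥0, ∀ (n : ℕ) (Ω : Type*) [MeasurableSpace Ω] (μ : Measure Ω) [IsProbabilityMeasure μ]
      (X : Fin n → Fin n → Ω → ℝ),
      (∀ i j, Measurable (X i j)) →
      iIndepFun (fun (q : Fin n × Fin n) => X q.1 q.2) μ →
      (∀ i j, Integrable (X i j) μ ∧ ∫ ω, X i j ω ∂μ = 0) →
      (∀ i j, ∀ p : ℝ, 1 ≤ p →
        RandomMatrixLower.lpNormRV μ (2 * p) (X i j)
          ≤ ENNReal.ofReal α * RandomMatrixLower.lpNormRV μ p (X i j)) →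
      RandomMatrixLower.maxRow μ X + RandomMatrixLower.maxCol μ X
          + RandomMatrixLower.maxMinWeak μ X
        ≤ (C : ℝ≥0∞) * RandomMatrixLower.expOpNorm μ X := by
  obtain ⟨a, ha⟩ := pow_unbounded_of_one_lt (8 * α) (one_lt_two (α := ℝ))
  set K : ℝ≥0∞ := ENNReal.ofReal α + ENNReal.ofReal α + weakConst α a with hK
  have hKt : K ≠ ⊤ := by
    have := weakConst_ne_top α a
    finiteness
  refine ⟨K.toNNReal, fun n Ω _ μ _ X hmeas hind h0 hreg => ?_⟩
  rw [ENNReal.coe_toNNReal hKt]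
  have h : IsRegularMatrix μ α X :=
    ⟨hmeas, hind, fun i j => (h0 i j).1, fun i j => (h0 i j).2, fun i j => hreg i j⟩
  rcases eq_or_ne (expOpNorm μ X) ⊤ with hM | hM
  -- In `[0, ∞]` one has `0 * ⊤ = 0`, so an infinite expected norm gives a trivial bound only
  -- because `K ≠ 0`.
  · have hK0 : K ≠ 0 := by
      have : ENNReal.ofReal α ≠ 0 := by simp; linarith
      simp [hK, this]
    rw [hM, ENNReal.mul_top hK0]
    exact le_top
  · rw [hK, add_mul, add_mul]
    exact add_le_add (add_le_add (maxRow_le h.integrable h.regular)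
      (maxCol_le h.integrable h.regular)) (h.maxMinWeak_le hα ha.le hM)
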